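/- **Setting.** A *disk pattern in $\mathbb{C}$* is a collection $Q$ of closed round disks in $\mathbb{C}$ (of positive finite radius) such that no disk has its boundary contained in the union of two other disks and no disk is the Hausdorff limit of a sequence of distinct disks of $Q$. Its *contact graph* has the disks as vertices, two distinct disks being joined by an edge if they intersect; the *dihedral angle* of two intersecting disks $D_1,D_2$ is the angle between the clockwise tangent of $\partial D_1$ and the counterclockwise tangent of $\partial D_2$ at a point of $\partial D_1\cap\partial D_2$. $Q$ is *locally finite in $\mathbb{C}$* if every compact subset of $\mathbb{C}$ intersects only finitely many disks of $Q$. Let $G$ be a graph with edge set $E$ and let $\Theta:E\to[0,\pi/2]$. Let $\tilde G$ be the graph obtained from $G$ by adding, for every simple loop $a,b,c,d$ in $G$ whose four edges have $\Theta=\pi/2$ and for which $[b,d]$ is an edge of $G$ with $\Theta([b,d])=0$, the edge $[a,c]$ (if it is not already in $G$). Let $\tilde\Theta=\Theta$ on $E$ and $\tilde\Theta=0$ on the added edges. $Q$ *realizes* $(G,\Theta)$ if its contact graph is $\tilde G$ (the disk corresponding to the vertex $v$ is denoted by $Q(v)$) and its dihedral angle function is $\tilde\Theta$. For a set $\Gamma$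 of sets of vertices of $G$ let $\mathrm{MOD}(\Gamma)=\inf_\eta\sum_v\eta(v)^2$ over all $\eta:V\to[0,\infty)$ with $\sum_{v\in\gamma}\eta(v)\ge 1$ for every $\gamma\in\Gamma$, and let $\mathrm{VEL}(\Gamma)=1/\mathrm{MOD}(\Gamma)\in[0,\infty]$. A connected graph $G$ is *VEL-parabolic* if $\mathrm{VEL}(\Gamma)=\infty$, where $\Gamma$ consists of the vertex sets of the paths in $G$ that start in $V_0$ and pass through infinitely many vertices, for a finite nonempty set $V_0$ of vertices (the choice of $V_0$ does not matter). **Corollary 6.2.** Let $T$ be a triangulation of the open topological disk, let $G$ be its one-skeleton, let $\Theta:E\to[0,\pi/2]$ be a function on the set of edges of $G$, and let $Q$ be a disk pattern in $\mathbb{C}$ which realizes $(G,\Theta)$. 1. If $Q$ is locally finite in $\mathbb{C}$, then $G$ is VEL-parabolic. 2. Conversely, suppose that $Q$ is immersed, that is, the map $|T|\to\mathbb{C}$ which is affine on each simplex of $T$ and sends each vertex $v$ to the center of $Q(v)$ is locally injective. If $G$ is VEL-parabolic, then $Q$ is locally finite in $\mathbb{C}$. In particular, for an immersed $Q$, the pattern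 $Q$ is locally finite in $\mathbb{C}$ if and only if $G$ is VEL-parabolic. -/

import Mathlib

open Set Filter Topology
open scoped NNReal ENNReal

noncomputable section

namespace HePattern

/-! ### Triangulations of the open disk -/

variable {V : Type*}

/-- The geometric realization `|T|` of an abstract simplicial complex, by barycentric coordinates:
nonnegative weights, supported in some face of `T`, of total mass `1`. It carries the topology of
pointwise convergence of the barycentric coordinates. On a locally finite complex this is the usual
(weak) topology; a complex whose realization is homeomorphic to the open disk, for either of the
two topologies, is locally finite, so that the two give the same triangulations of the disk. -/
def geomRealization (T : AbstractSimplicialComplex V) : Set (V → ℝ) :=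
  {x | (∀ v, 0 ≤ x v) ∧ ∃ s ∈ T.faces, (∀ v, v ∉ s → x v = 0) ∧ ∑ v ∈ s, x v = 1}

/-- The one-skeleton of `T` as a graph on its vertices: two distinct vertices are joined if they
lie in a common face (equivalently, as faces are closed under passing to nonempty subsets, if they
are the two ends of a 1-simplex of `T`). -/
def oneSkeleton (T : AbstractSimplicialComplex V) : SimpleGraph V where
  Adj u v := u ≠ v ∧ ∃ s ∈ T.faces, u ∈ s ∧ v ∈ s
  symm := ⟨fun _ _ h => ⟨h.1.symm, h.2.imp fun _ hs => ⟨hs.1, hs.2.2, hs.2.1⟩⟩⟩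
  loopless := ⟨fun _ h => h.1 rfl⟩

/-- `T` is a triangulation of the open topological disk: its simplices are vertices, edges and
triangles, and `|T|` is homeomorphic to the open unit disk. -/
def IsOpenDiskTriangulation (T : AbstractSimplicialComplex V) : Prop :=
  (∀ s ∈ T.faces, s.card ≤ 3) ∧ Nonempty (geomRealization T ≃ₜ Metric.ball (0 : ℂ) 1)

/-! ### Disk patterns in the plane -/

/-- A closed round disk in `ℂ`, of positive finite radius. -/
structure PlaneDisk where
  center : ℂ
  radius : ℝ
  radius_pos : 0 < radius

namespace PlaneDisk

/-- The closed disk as a set of points. -/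
def toSet (D : PlaneDisk) : Set ℂ := Metric.closedBall D.center D.radius

/-- The boundary circle. -/
def circle (D : PlaneDisk) : Set ℂ := Metric.sphere D.center D.radius

/-- A counterclockwise tangent vector of the boundary circle of `D` at its point `p`. -/
def ccwTangent (D : PlaneDisk) (p : ℂ) : ℂ := Complex.I * (p - D.center)

/-- A clockwise tangent vector of the boundary circle of `D` at its point `p`. -/
def cwTangent (D : PlaneDisk) (p : ℂ) : ℂ := -D.ccwTangent p

/-- `D₁` and `D₂` have dihedral angle `θ`: this is the angle between the clockwise tangent of
`∂D₁` and the counterclockwise tangent of `∂D₂` at a point of `∂D₁ ∩ ∂D₂`. (If there are two such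
points, they give the same angle, by reflection in the line of centers.) -/
def HasDihedralAngle (D₁ D₂ : PlaneDisk) (θ : ℝ) : Prop :=
  ∃ p ∈ D₁.circle ∩ D₂.circle, InnerProductGeometry.angle (D₁.cwTangent p) (D₂.ccwTangent p) = θ

end PlaneDisk

/-- A disk pattern in `ℂ` whose (pairwise distinct) disks are labelled by `V`: no disk has its
boundary contained in the union of two other disks, and no disk is the Hausdorff limit of a
sequence of distinct disks of the pattern. -/
structure DiskPattern (V : Type*) where
  disk : V → PlaneDisk
  injective : Function.Injective disk
  boundary_not_covered : ∀ u v w : V, v ≠ u → w ≠ u →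
    ¬ (disk u).circle ⊆ (disk v).toSet ∪ (disk w).toSet
  not_hausdorff_limit : ∀ (u : V) (s : ℕ → V), Function.Injective s →
    ¬ Tendsto (fun n => Metric.hausdorffDist (disk (s n)).toSet (disk u).toSet) atTop (𝓝 0)

namespace DiskPattern

/-- The contact graph: two distinct disks are joined by an edge if they intersect. -/
def contactGraph (Q : DiskPattern V) : SimpleGraph V where
  Adj u v := u ≠ v ∧ ((Q.disk u).toSet ∩ (Q.disk v).toSet).Nonempty
  symm := ⟨fun _ _ h => ⟨h.1.symm, by rw [inter_comm]; exact h.2⟩⟩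
  loopless := ⟨fun _ h => h.1 rfl⟩

/-- The pattern is locally finite in `Ω`: all its disks lie in `Ω`, and every compact subset of
`Ω` intersects only finitely many of them. -/
def LocallyFiniteIn (Q : DiskPattern V) (Ω : Set ℂ) : Prop :=
  (∀ v, (Q.disk v).toSet ⊆ Ω) ∧
    ∀ K : Set ℂ, K ⊆ Ω → IsCompact K → {v | ((Q.disk v).toSet ∩ K).Nonempty}.Finite

/-- The map `|T| → ℂ` that sends each vertex to the center of its disk and is affine on each
simplex of `T`. -/
def centerMap (Q : DiskPattern V) (T : AbstractSimplicialComplex V) (x : geomRealization T) : ℂ :=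
  ∑ᶠ v, (x : V → ℝ) v • (Q.disk v).center

/-- The map of `|T|` given by the triangles spanned by the centers of the disks, one for each
2-simplex of `T`, is an immersion into the plane, that is, it is locally injective. -/
def IsImmersed (Q : DiskPattern V) (T : AbstractSimplicialComplex V) : Prop :=
  IsLocallyInjective (Q.centerMap T)

end DiskPattern

/-! ### The data `(G, Θ)` and their realizations -/

/-- `u` and `v` are the ends of an edge of `G` at which the function `Θ` takes the value `θ`. -/
def EdgeValue {G : SimpleGraph V} (Θ : G.edgeSet → ℝ) (u v : V) (θ : ℝ) : Prop :=
  ∃ h : s(u, v) ∈ G.edgeSet, Θ ⟨s(u, v), h⟩ = θ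

/-- `a, b, c, d` is a simple loop in `G` with `Θ = π/2` on its four edges, and its diagonal
`[b, d]` is an edge of `G` with `Θ = 0`. -/
def IsReducibleSquare {G : SimpleGraph V} (Θ : G.edgeSet → ℝ) (a b c d : V) : Prop :=
  a ≠ c ∧ EdgeValue Θ a b (Real.pi / 2) ∧ EdgeValue Θ b c (Real.pi / 2) ∧
    EdgeValue Θ c d (Real.pi / 2) ∧ EdgeValue Θ d a (Real.pi / 2) ∧ EdgeValue Θ b d 0

theorem EdgeValue.symm {G : SimpleGraph V} {Θ : G.edgeSet → ℝ} {u v : V} {θ : ℝ}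
    (h : EdgeValue Θ u v θ) : EdgeValue Θ v u θ := by
  unfold EdgeValue at h ⊢
  rwa [Sym2.eq_swap]

theorem IsReducibleSquare.swap {G : SimpleGraph V} {Θ : G.edgeSet → ℝ} {a b c d : V}
    (h : IsReducibleSquare Θ a b c d) : IsReducibleSquare Θ c b a d :=
  ⟨h.1.symm, h.2.2.1.symm, h.2.1.symm, h.2.2.2.2.1.symm, h.2.2.2.1.symm, h.2.2.2.2.2⟩

/-- The graph `G̃`: the graph `G`, together with the other diagonal `[a, c]` of every loop
`a, b, c, d` as in `IsReducibleSquare`. -/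
def extendedGraph {G : SimpleGraph V} (Θ : G.edgeSet → ℝ) : SimpleGraph V where
  Adj a c := G.Adj a c ∨ ∃ b d, IsReducibleSquare Θ a b c d
  symm := ⟨fun _ _ h => h.imp (fun h => h.symm) fun ⟨b, d, h⟩ => ⟨b, d, h.swap⟩⟩
  loopless := ⟨fun _ h => h.elim (fun h => h.ne rfl) fun ⟨_, _, h⟩ => h.1 rfl⟩

open Classical in
/-- The function `Θ̃`: it is `Θ` on the edges of `G`, and `0` on the added edges. -/
def extendedAngle {G : SimpleGraph V} (Θ : G.edgeSet → ℝ) (e : Sym2 V) : ℝ :=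
  if h : e ∈ G.edgeSet then Θ ⟨e, h⟩ else 0

/-- `Q` realizes the data `(G, Θ)`, the disk `Q.disk v` being the one that corresponds to the
vertex `v`: its contact graph is `G̃` and its dihedral angle function is `Θ̃`. -/
def DiskPattern.Realizes (Q : DiskPattern V) {G : SimpleGraph V} (Θ : G.edgeSet → ℝ) : Prop :=
  Q.contactGraph = extendedGraph Θ ∧
    ∀ u v, (extendedGraph Θ).Adj u v →
      (Q.disk u).HasDihedralAngle (Q.disk v) (extendedAngle Θ s(u, v))

/-! ### Vertex extremal length -/

/-- The area of a vertex metric. -/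
def area (η : V → ℝ≥0) : ℝ≥0∞ := ∑' v, (η v : ℝ≥0∞) ^ 2

/-- The length of a vertex curve, that is, of a set of vertices. -/
def length (η : V → ℝ≥0) (γ : Set V) : ℝ≥0∞ := ∑' v : γ, (η v : ℝ≥0∞)

/-- A vertex metric is admissible for a collection of vertex curves if they all have
length at least `1`. -/
def Admissible (Γ : Set (Set V)) (η : V → ℝ≥0) : Prop := ∀ γ ∈ Γ, 1 ≤ length η γ

/-- The vertex modulus. -/
def vertexModulus (Γ : Set (Set V)) : ℝ≥0∞ := ⨅ (η : V → ℝ≥0) (_ : Admissible Γ η), area η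

/-- The vertex extremal length; here `0⁻¹ = ∞` and `∞⁻¹ = 0`, and it is `∞` for the empty
collection. -/
def vertexExtremalLength (Γ : Set (Set V)) : ℝ≥0∞ := (vertexModulus Γ)⁻¹

/-- The vertex curves of the paths in `G` that join `V₀` and `∞`: the paths that start at a vertex
of `V₀` and pass through infinitely many vertices. -/
def curvesToInfinity (G : SimpleGraph V) (V₀ : Set V) : Set (Set V) :=
  {γ | ∃ p : ℕ → V, p 0 ∈ V₀ ∧ (∀ k, G.Adj (p k) (p (k + 1))) ∧ (range p).Infinite ∧ γ = range p}

/-- `G` is VEL-parabolic: it is connected, and `VEL(V₀, ∞) = ∞` for a finite nonvoid set `V₀` of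
vertices. (In a connected graph this does not depend on the choice of `V₀`.) -/
def VELParabolic (G : SimpleGraph V) : Prop :=
  G.Connected ∧ ∃ V₀ : Set V, V₀.Finite ∧ V₀.Nonempty ∧
    vertexExtremalLength (curvesToInfinity G V₀) = ⊤

end HePattern

end

open HePattern

noncomputable section

namespace HePattern

variable {V : Type*}

/-! ### Planar geometry of disk patterns with nonobtuse angles -/

/-! Angles at most π/2 say that any two disks satisfy `|c_u - c_v|² ≥ r_u² + r_v²`. Seen from a
common point, the centers of the disks through it then lie in distinct quadrants, so a point belongs
to at most four disks; integrating this bounds the truncated area of the disks meeting a ball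
(`DiskPattern.Nonobtuse.tsum_sq_le`). Every area estimate below rests on that bound.

Locally finite implies parabolic: weighting each disk by its relative width in the annulus `R < |z|
< 2R` gives a metric of area at most 256 for which every path across the annulus has length at least
1. Local finiteness makes its support finite, so arbitrarily many such metrics with disjoint
supports exist, and the average of n of them has area at most 256/n.

Conversely, let f be the center map of an immersed pattern. It is open by invariance of domain. It
is injective on each closed star; moreover an edge of a face and an edge avoiding that face cross
only at a common point of tangency, and then the disks across are orthogonal, hence adjacent
(`crossing_segments`). This excludes overlaps of disjoint faces, so f is globally injective
(`DiskPattern.Fits.centerMap_injective`). If f omitted a point p, its simply connected image would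
contain no circle around p. For each r in an interval, an arc of the circle of radius r around p
would then run from a point near a base vertex out of the image, and the stars it meets would carry
a path to infinity. The squared widths of the disks involved are summable, so the length-area method
(`vertexModulus_ne_zero`) gives positive modulus, against parabolicity. Hence f is onto, and local
finiteness follows by covering a compact ball with finitely many images of open stars. -/

/-- Any two disks meet at an angle at most `π / 2`, or are disjoint. -/
def DiskPattern.Nonobtuse (Q : DiskPattern V) : Prop :=
  ∀ u v, u ≠ v → (Q.disk u).radius ^ 2 + (Q.disk v).radius ^ 2 ≤
    dist (Q.disk u).center (Q.disk v).center ^ 2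

/-- The law of cosines: both tangents are radius vectors at `p` turned by a quarter turn, and the
opposite orientation of the first one turns the usual minus sign into a plus. -/
theorem PlaneDisk.HasDihedralAngle.dist_sq {D₁ D₂ : PlaneDisk} {θ : ℝ}
    (h : D₁.HasDihedralAngle D₂ θ) :
    dist D₁.center D₂.center ^ 2 =
      D₁.radius ^ 2 + D₂.radius ^ 2 + 2 * D₁.radius * D₂.radius * Real.cos θ := by
  obtain ⟨p, ⟨h1, h2⟩, rfl⟩ := h
  have n1 : ‖p - D₁.center‖ = D₁.radius := by rw [← dist_eq_norm]; exact h1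
  have n2 : ‖p - D₂.center‖ = D₂.radius := by rw [← dist_eq_norm]; exact h2
  have m1 : ‖D₁.cwTangent p‖ = D₁.radius := by
    simp [PlaneDisk.cwTangent, PlaneDisk.ccwTangent, n1]
  have m2 : ‖D₂.ccwTangent p‖ = D₂.radius := by
    simp [PlaneDisk.ccwTangent, n2]
  have key := InnerProductGeometry.cos_angle_mul_norm_mul_norm (D₁.cwTangent p) (D₂.ccwTangent p)
  rw [m1, m2] at key
  have e : dist D₁.center D₂.center ^ 2 = ‖p - D₁.center‖ ^ 2 + ‖p - D₂.center‖ ^ 2 +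
      2 * inner ℝ (D₁.cwTangent p) (D₂.ccwTangent p) := by
    simp only [dist_eq_norm, Complex.sq_norm, Complex.normSq_apply, Complex.inner,
      PlaneDisk.cwTangent, PlaneDisk.ccwTangent]
    simp
    ring
  rw [e, n1, n2, ← key]
  ring

theorem DiskPattern.contactGraph_adj_iff (Q : DiskPattern V) (u v : V) :
    Q.contactGraph.Adj u v ↔
      u ≠ v ∧ dist (Q.disk u).center (Q.disk v).center ≤ (Q.disk u).radius + (Q.disk v).radius := by
  change _ ∧ _ ↔ _
  refine and_congr_right fun _ => ?_
  constructor
  · rintro ⟨z, h1, h2⟩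
    have h1' : dist z (Q.disk u).center ≤ _ := h1
    have h2' : dist z (Q.disk v).center ≤ _ := h2
    linarith [dist_triangle_left (Q.disk u).center (Q.disk v).center z]
  · intro h
    have hu := (Q.disk u).radius_pos
    have hv := (Q.disk v).radius_pos
    obtain ⟨z, h1, h2⟩ := exists_dist_le_le hu.le hv.le (h.trans_eq (add_comm _ _))
    exact ⟨z, by simpa [PlaneDisk.toSet, dist_comm] using h1,
      by simpa [PlaneDisk.toSet, dist_comm] using h2⟩

section Realizes

variable {G : SimpleGraph V} {Θ : G.edgeSet → ℝ} {Q : DiskPattern V}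

theorem extendedAngle_mem (hΘ : ∀ e, Θ e ∈ Set.Icc 0 (Real.pi / 2)) (e : Sym2 V) :
    extendedAngle Θ e ∈ Set.Icc 0 (Real.pi / 2) := by
  unfold extendedAngle
  split_ifs with h
  · exact hΘ _
  · exact ⟨le_rfl, by positivity⟩

theorem DiskPattern.Realizes.nonobtuse (hQ : Q.Realizes Θ)
    (hΘ : ∀ e, Θ e ∈ Set.Icc 0 (Real.pi / 2)) : Q.Nonobtuse := by
  intro u v huv
  have hu := (Q.disk u).radius_pos
  have hv := (Q.disk v).radius_pos
  by_cases h : Q.contactGraph.Adj u v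
  · have ha := hQ.2 u v (hQ.1 ▸ h)
    rw [ha.dist_sq]
    have hc := extendedAngle_mem hΘ s(u, v)
    have := Real.cos_nonneg_of_neg_pi_div_two_le_of_le (by linarith [hc.1, Real.pi_pos]) hc.2
    have : 0 ≤ 2 * (Q.disk u).radius * (Q.disk v).radius *
      Real.cos (extendedAngle Θ s(u, v)) := by positivity
    linarith
  · rw [Q.contactGraph_adj_iff] at h
    push Not at h
    nlinarith [h huv]

theorem DiskPattern.Realizes.dist_le (hQ : Q.Realizes Θ) {u v : V} (h : G.Adj u v) :
    dist (Q.disk u).center (Q.disk v).center ≤ (Q.disk u).radius + (Q.disk v).radius := by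
  have : Q.contactGraph.Adj u v := hQ.1 ▸ Or.inl h
  exact ((Q.contactGraph_adj_iff u v).1 this).2

/-- Orthogonal disks overlap, so they are joined in the extended graph. An added edge has angle 0,
that is, its disks are tangent; it is therefore never orthogonal. -/
theorem DiskPattern.Realizes.adj_of_dist_sq_eq (hQ : Q.Realizes Θ) {u v : V} (huv : u ≠ v)
    (h : dist (Q.disk u).center (Q.disk v).center ^ 2 =
      (Q.disk u).radius ^ 2 + (Q.disk v).radius ^ 2) : G.Adj u v := by
  have hu := (Q.disk u).radius_pos
  have hv := (Q.disk v).radius_pos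
  have hadj : Q.contactGraph.Adj u v := by
    rw [Q.contactGraph_adj_iff]
    exact ⟨huv, by nlinarith [dist_nonneg (x := (Q.disk u).center) (y := (Q.disk v).center)]⟩
  have ha := (hQ.2 u v (hQ.1 ▸ hadj)).dist_sq
  by_contra hG
  have : extendedAngle Θ s(u, v) = 0 := by
    unfold extendedAngle
    rw [dif_neg]
    simpa using hG
  rw [this, h, Real.cos_zero] at ha
  nlinarith [mul_pos hu hv]

end Realizes

/-- Two segments whose endpoints carry disks that overlap along the segments but not obtusely
across them can only cross at a common point of tangency. -/
theorem crossing_segments {a b c d : ℂ} {ra rb rc rd s t : ℝ}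
    (hs : s ∈ Icc (0 : ℝ) 1) (ht : t ∈ Icc (0 : ℝ) 1)
    (hz : (1 - s) • a + s • b = (1 - t) • c + t • d)
    (hab : dist a b ≤ ra + rb) (hcd : dist c d ≤ rc + rd)
    (hac : ra ^ 2 + rc ^ 2 ≤ dist a c ^ 2) (had : ra ^ 2 + rd ^ 2 ≤ dist a d ^ 2)
    (hbc : rb ^ 2 + rc ^ 2 ≤ dist b c ^ 2) (hbd : rb ^ 2 + rd ^ 2 ≤ dist b d ^ 2) :
    (1 - s) * ra = s * rb ∧ (1 - t) * rc = t * rd ∧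
      (1 - s) * (1 - t) * (dist a c ^ 2 - (ra ^ 2 + rc ^ 2)) = 0 := by
  obtain ⟨hs0, hs1⟩ := hs
  obtain ⟨ht0, ht1⟩ := ht
  -- Expansion of the squared distance between the two points on the segments; it vanishes since the
  -- points coincide.
  have id1 : (1 - s) * (1 - t) * dist a c ^ 2 + (1 - s) * t * dist a d ^ 2 +
      s * (1 - t) * dist b c ^ 2 + s * t * dist b d ^ 2 -
      s * (1 - s) * dist a b ^ 2 - t * (1 - t) * dist c d ^ 2 =
      ‖((1 - s) • a + s • b) - ((1 - t) • c + t • d)‖ ^ 2 := by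
    simp only [dist_eq_norm, Complex.sq_norm, Complex.normSq_apply]
    simp
    ring
  rw [hz, sub_self, norm_zero] at id1
  have hab2 : dist a b ^ 2 ≤ (ra + rb) ^ 2 := pow_le_pow_left₀ dist_nonneg hab 2
  have hcd2 : dist c d ^ 2 ≤ (rc + rd) ^ 2 := pow_le_pow_left₀ dist_nonneg hcd 2
  have s1 : 0 ≤ 1 - s := by linarith
  have t1 : 0 ≤ 1 - t := by linarith
  have e1 := mul_le_mul_of_nonneg_left hac (mul_nonneg s1 t1)
  have e2 := mul_le_mul_of_nonneg_left had (mul_nonneg s1 ht0)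
  have e3 := mul_le_mul_of_nonneg_left hbc (mul_nonneg hs0 t1)
  have e4 := mul_le_mul_of_nonneg_left hbd (mul_nonneg hs0 ht0)
  have e5 := mul_le_mul_of_nonneg_left hab2 (mul_nonneg hs0 s1)
  have e6 := mul_le_mul_of_nonneg_left hcd2 (mul_nonneg ht0 t1)
  have q1 := sq_nonneg ((1 - s) * ra - s * rb)
  have q2 := sq_nonneg ((1 - t) * rc - t * rd)
  -- Once the bounds are inserted, the radii in `id1` assemble into exactly these two squares. All
  -- three summands are nonnegative, so each vanishes.
  have sum : ((1 - s) * ra - s * rb) ^ 2 + ((1 - t) * rc - t * rd) ^ 2 +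
      (1 - s) * (1 - t) * (dist a c ^ 2 - (ra ^ 2 + rc ^ 2)) ≤ 0 := by linarith
  have q3 : 0 ≤ (1 - s) * (1 - t) * (dist a c ^ 2 - (ra ^ 2 + rc ^ 2)) := by linarith
  have z1 : ((1 - s) * ra - s * rb) ^ 2 = 0 := by linarith
  have z2 : ((1 - t) * rc - t * rd) ^ 2 = 0 := by linarith
  refine ⟨sub_eq_zero.1 (pow_eq_zero_iff two_ne_zero |>.1 z1),
    sub_eq_zero.1 (pow_eq_zero_iff two_ne_zero |>.1 z2), by linarith⟩

/-- In a nonobtuse pattern the center of a third disk does not lie on the segment between the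
centers of two overlapping disks. -/
theorem center_notMem_segment {a b c : ℂ} {ra rb rc s : ℝ} (hc : 0 < rc)
    (hs : s ∈ Icc (0 : ℝ) 1) (hz : (1 - s) • a + s • b = c) (hab : dist a b ≤ ra + rb)
    (hac : ra ^ 2 + rc ^ 2 ≤ dist a c ^ 2) (hbc : rb ^ 2 + rc ^ 2 ≤ dist b c ^ 2) : False := by
  -- The second segment is degenerate, with both ends at `c` and `t = 0`; the balance of radii on it
  -- reads `rc = 0`.
  have := (crossing_segments (t := 0) (c := c) (d := c) (rc := rc) (rd := rc) hs (by simp)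
    (by simpa using hz) hab (by simpa using hc.le) hac hac hbc hbc).2.1
  simp at this
  exact hc.ne' this

/-- The half-open quadrant of a nonzero complex number. -/
def quadrant (w : ℂ) : Fin 4 :=
  if 0 < w.re then (if 0 ≤ w.im then 0 else 3)
  else if 0 < w.im then 1 else if w.re < 0 then 2 else 3

/-- Up to a quarter turn both numbers lie in the half-open quadrant where one coordinate is positive
and the other nonnegative. -/
theorem inner_pos_of_quadrant_eq {w z : ℂ} (hw : w ≠ 0) (hz : z ≠ 0)
    (h : quadrant w = quadrant z) : 0 < w.re * z.re + w.im * z.im := by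
  have pos_add : ∀ {x y x' y' : ℝ}, 0 < x → 0 ≤ y → 0 < x' → 0 ≤ y' →
      0 < x * x' + y * y' := fun h1 h2 h3 h4 => by positivity
  have aux : ∀ w : ℂ, w ≠ 0 → (0 < w.re ∧ 0 ≤ w.im ∧ quadrant w = 0) ∨
      (0 < w.im ∧ 0 ≤ -w.re ∧ quadrant w = 1) ∨ (0 < -w.re ∧ 0 ≤ -w.im ∧ quadrant w = 2) ∨
      (0 < -w.im ∧ 0 ≤ w.re ∧ quadrant w = 3) := by
    intro w hw
    unfold quadrant
    rcases lt_trichotomy w.re 0 with h1 | h1 | h1 <;>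
      rcases lt_trichotomy w.im 0 with h2 | h2 | h2 <;>
      simp [h1, h1.le, h2.le, not_lt.2 h1.le, not_lt.2 h2.le, not_le.2, h2]
    exact hw (Complex.ext h1 h2)
  rcases aux w hw with ⟨a, b, c⟩ | ⟨a, b, c⟩ | ⟨a, b, c⟩ | ⟨a, b, c⟩ <;>
    rcases aux z hz with ⟨d, e, f⟩ | ⟨d, e, f⟩ | ⟨d, e, f⟩ | ⟨d, e, f⟩ <;>
    rw [c, f] at h <;> first | exact absurd h (by decide) | linarith [pos_add a b d e]

/-- At most four disks of a nonobtuse pattern contain a given point. -/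
theorem DiskPattern.Nonobtuse.encard_le {Q : DiskPattern V} (hQ : Q.Nonobtuse) (z : ℂ) :
    {v | z ∈ (Q.disk v).toSet}.encard ≤ 4 := by
  set S := {v | z ∈ (Q.disk v).toSet}
  -- Two centers in the same quadrant around `z` would make a positive inner product, hence a
  -- distance too small for a nonobtuse pair.
  have hinj : InjOn (fun v => quadrant ((Q.disk v).center - z)) S := by
    intro u hu v hv huv
    by_contra hne
    have h := hQ u v hne
    have hu' : dist (Q.disk u).center z ≤ (Q.disk u).radius := by rw [dist_comm]; exact hu
    have hv' : dist (Q.disk v).center z ≤ (Q.disk v).radius := by rw [dist_comm]; exact hv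
    have hu2 := pow_le_pow_left₀ dist_nonneg hu' 2
    have hv2 := pow_le_pow_left₀ dist_nonneg hv' 2
    have ru := sq_pos_of_pos (Q.disk u).radius_pos
    have rv := sq_pos_of_pos (Q.disk v).radius_pos
    have e : dist (Q.disk u).center (Q.disk v).center ^ 2 = dist (Q.disk u).center z ^ 2 +
        dist (Q.disk v).center z ^ 2 - 2 * (((Q.disk u).center - z).re *
          ((Q.disk v).center - z).re + ((Q.disk u).center - z).im * ((Q.disk v).center - z).im) := by
      simp only [dist_eq_norm, Complex.sq_norm, Complex.normSq_apply, Complex.sub_re,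
        Complex.sub_im]
      ring
    have n1 : (Q.disk u).center - z ≠ 0 := by
      intro h0
      rw [sub_eq_zero.1 h0] at h hu2 e
      simp only [dist_self, sub_self, Complex.zero_re, Complex.zero_im] at e
      linarith
    have n2 : (Q.disk v).center - z ≠ 0 := by
      intro h0
      rw [sub_eq_zero.1 h0] at h hv2 e
      simp only [dist_self, sub_self, Complex.zero_re, Complex.zero_im] at e
      linarith
    linarith [inner_pos_of_quadrant_eq n1 n2 huv]
  calc S.encard = ((fun v => quadrant ((Q.disk v).center - z)) '' S).encard := (hinj.encard_image).symm
    _ ≤ (univ : Set (Fin 4)).encard := encard_le_encard (subset_univ _)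
    _ = 4 := by simp

/-- The concentric disks of half the radius are disjoint open sets in a separable space. -/
theorem DiskPattern.Nonobtuse.countable {Q : DiskPattern V} (hQ : Q.Nonobtuse) : Countable V := by
  have hd : (univ : Set V).PairwiseDisjoint
      fun v => Metric.ball (Q.disk v).center ((Q.disk v).radius / 2) := by
    intro u _ v _ huv
    refine Metric.ball_disjoint_ball ?_
    have hu := (Q.disk u).radius_pos
    have hv := (Q.disk v).radius_pos
    refine abs_le_of_sq_le_sq' ?_ dist_nonneg |>.2
    nlinarith [hQ u v huv, sq_nonneg ((Q.disk u).radius - (Q.disk v).radius)]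
  have := hd.countable_of_isOpen (fun v _ => Metric.isOpen_ball)
    (fun v _ => Metric.nonempty_ball.2 (half_pos (Q.disk v).radius_pos))
  exact Set.countable_univ_iff.1 this

/-- A disk that meets `closedBall p M` contains a disk of radius `min r R` close to `p`. -/
theorem PlaneDisk.exists_closedBall_subset (D : PlaneDisk) {p : ℂ} {M R : ℝ} (hR : 0 < R)
    (h : (D.toSet ∩ Metric.closedBall p M).Nonempty) :
    ∃ c, Metric.closedBall c (min D.radius R) ⊆ D.toSet ∩ Metric.closedBall p (M + 2 * R) := by
  obtain ⟨z, hz1, hz2⟩ := h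
  have hz1 : dist z D.center ≤ D.radius := hz1
  have hz2 : dist z p ≤ M := hz2
  have hr := D.radius_pos
  obtain ⟨c, h1, h2⟩ := exists_dist_le_le (x := D.center) (z := z) (δ := D.radius - min D.radius R)
    (ε := min D.radius R) (by linarith [min_le_left D.radius R]) (le_min hr.le hR.le)
    (by rw [dist_comm]; linarith)
  refine ⟨c, fun w hw => ?_⟩
  have hw : dist w c ≤ min D.radius R := hw
  constructor
  · change dist w D.center ≤ D.radius
    linarith [dist_triangle_right w D.center c]
  · change dist w p ≤ M + 2 * R
    linarith [dist_triangle w c p, dist_triangle c z p, min_le_right D.radius R]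

open MeasureTheory in
/-- The total truncated area of the disks that meet a ball. -/
theorem DiskPattern.Nonobtuse.tsum_sq_le {Q : DiskPattern V} (hQ : Q.Nonobtuse) (p : ℂ)
    {M R : ℝ} (hR : 0 < R) :
    ∑' v : {v | ((Q.disk v).toSet ∩ Metric.closedBall p M).Nonempty},
      ENNReal.ofReal (min (Q.disk v).radius R) ^ 2 ≤ 4 * ENNReal.ofReal (M + 2 * R) ^ 2 := by
  have := hQ.countable
  set S := {v | ((Q.disk v).toSet ∩ Metric.closedBall p M).Nonempty}
  choose c hc using fun v : S => (Q.disk v).exists_closedBall_subset hR v.2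
  -- Each disk contributes a ball contained in it and in the larger ball around `p`; these balls
  -- cover a point at most four times.
  have h1 : ∑' v : S, volume (Metric.closedBall (c v) (min (Q.disk v).radius R)) ≤
      4 * volume (Metric.closedBall p (M + 2 * R)) := by
    calc ∑' v : S, volume (Metric.closedBall (c v) (min (Q.disk v).radius R))
        = ∑' v : S, ∫⁻ z, (Metric.closedBall (c v) (min (Q.disk v).radius R)).indicator 1 z :=
          tsum_congr fun v => (lintegral_indicator_one Metric.isClosed_closedBall.measurableSet).symm
      _ = ∫⁻ z, ∑' v : S, (Metric.closedBall (c v) (min (Q.disk v).radius R)).indicator 1 z :=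
          (lintegral_tsum fun v => (measurable_one.indicator
            Metric.isClosed_closedBall.measurableSet).aemeasurable).symm
      _ ≤ ∫⁻ z, (Metric.closedBall p (M + 2 * R)).indicator (fun _ => 4) z := by
          refine lintegral_mono fun z => ?_
          by_cases hz : z ∈ Metric.closedBall p (M + 2 * R)
          · rw [indicator_of_mem hz]
            calc ∑' v : S, (Metric.closedBall (c v) (min (Q.disk v).radius R)).indicator 1 z
                ≤ ∑' v : S, ({v | z ∈ (Q.disk v).toSet} : Set V).indicator (1 : V → ℝ≥0∞) v := by
                  refine ENNReal.tsum_le_tsum fun v => ?_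
                  by_cases hzv : z ∈ Metric.closedBall (c v) (min (Q.disk v).radius R)
                  · rw [indicator_of_mem hzv,
                      indicator_of_mem (show (v : V) ∈ {v | z ∈ (Q.disk v).toSet} from (hc v hzv).1)]
                    rfl
                  · rw [indicator_of_notMem hzv]
                    exact zero_le
              _ ≤ ∑' v, ({v | z ∈ (Q.disk v).toSet} : Set V).indicator (1 : V → ℝ≥0∞) v :=
                  ENNReal.tsum_comp_le_tsum_of_injective Subtype.val_injective _
              _ = ({v | z ∈ (Q.disk v).toSet}.encard : ℝ≥0∞) := by
                  rw [← tsum_subtype]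
                  exact ENNReal.tsum_set_one _
              _ ≤ 4 := by exact_mod_cast hQ.encard_le z
          · rw [indicator_of_notMem hz, nonpos_iff_eq_zero, ENNReal.tsum_eq_zero]
            exact fun v => indicator_of_notMem (fun h => hz (hc v h).2) _
      _ = 4 * volume (Metric.closedBall p (M + 2 * R)) :=
          lintegral_indicator_const Metric.isClosed_closedBall.measurableSet _
  simp only [Complex.volume_closedBall, ENNReal.tsum_mul_right] at h1
  rw [← mul_assoc] at h1
  exact (ENNReal.mul_le_mul_iff_left (by simp [NNReal.pi_ne_zero]) (by simp)).1 h1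

/-! ### Connectedness of graphs carried by subsets of the realization -/

theorem oneSkeleton_adj_of_pos {T : AbstractSimplicialComplex V} (x : geomRealization T) {u v : V}
    (hu : 0 < x.1 u) (hv : 0 < x.1 v) (huv : u ≠ v) : (oneSkeleton T).Adj u v := by
  obtain ⟨-, s, hs, hsupp, -⟩ := x.2
  exact ⟨huv, s, hs, by_contra fun h => hu.ne' (hsupp u h), by_contra fun h => hv.ne' (hsupp v h)⟩

/-- When two of the sets `U v` share a point, both vertices have positive weight there and are equal
or adjacent. A splitting of the graph would thus split `A` into two disjoint relatively open parts.
-/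
theorem induce_preconnected_of_isPreconnected {T : AbstractSimplicialComplex V}
    {A : Set (geomRealization T)} (hA : IsPreconnected A) {U : V → Set (geomRealization T)}
    (hU : ∀ v, IsOpen (U v)) (hpos : ∀ v, ∀ x ∈ U v, 0 < x.1 v) (hcov : A ⊆ ⋃ v, U v) :
    ((oneSkeleton T).induce {v | (A ∩ U v).Nonempty}).Preconnected := by
  rintro a b
  by_contra hab
  set H := (oneSkeleton T).induce {v | (A ∩ U v).Nonempty}
  obtain ⟨x, hxA, hx1, hx2⟩ := hA (⋃ v : {v | H.Reachable a v}, U (v : {v | (A ∩ U v).Nonempty}))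
    (⋃ v : {v | ¬ H.Reachable a v}, U (v : {v | (A ∩ U v).Nonempty}))
    (isOpen_iUnion fun v => hU _) (isOpen_iUnion fun v => hU _) (by
      intro x hx
      obtain ⟨v, hv⟩ := mem_iUnion.1 (hcov hx)
      by_cases h : H.Reachable a ⟨v, x, hx, hv⟩
      · exact Or.inl (mem_iUnion.2 ⟨⟨_, h⟩, hv⟩)
      · exact Or.inr (mem_iUnion.2 ⟨⟨_, h⟩, hv⟩))
    (by
      obtain ⟨x, hx, hxa⟩ := a.2
      exact ⟨x, hx, mem_iUnion.2 ⟨⟨a, SimpleGraph.Reachable.refl a⟩, hxa⟩⟩)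
    (by
      obtain ⟨x, hx, hxb⟩ := b.2
      exact ⟨x, hx, mem_iUnion.2 ⟨⟨b, hab⟩, hxb⟩⟩)
  obtain ⟨⟨v, hv⟩, hxv⟩ := mem_iUnion.1 hx1
  obtain ⟨⟨w, hw⟩, hxw⟩ := mem_iUnion.1 hx2
  by_cases hvw : (v : V) = w
  · exact hw (Subtype.ext hvw ▸ hv)
  · refine hw (SimpleGraph.Reachable.trans hv (SimpleGraph.Adj.reachable ?_))
    exact oneSkeleton_adj_of_pos x (hpos _ _ hxv) (hpos _ _ hxw) hvw

theorem isOpen_openStar (T : AbstractSimplicialComplex V) (v : V) :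
    IsOpen {x : geomRealization T | 0 < x.1 v} :=
  isOpen_lt continuous_const ((continuous_apply v).comp continuous_subtype_val)

theorem exists_pos (T : AbstractSimplicialComplex V) (x : geomRealization T) : ∃ v, 0 < x.1 v := by
  obtain ⟨hnn, s, -, -, hsum⟩ := x.2
  by_contra! h
  rw [Finset.sum_eq_zero fun v _ => le_antisymm (h v) (hnn v)] at hsum
  exact zero_ne_one hsum

open Classical in
/-- The vertex `v` as a point of the realization. -/
def vertexPoint (T : AbstractSimplicialComplex V) (v : V) : geomRealization T :=
  ⟨Pi.single v 1, fun w => by by_cases h : w = v <;> simp [h], {v},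
    T.singleton_mem v, fun w hw => by simp at hw; simp [hw], by simp⟩

theorem oneSkeleton_connected {T : AbstractSimplicialComplex V} (hT : IsOpenDiskTriangulation T) :
    (oneSkeleton T).Connected := by
  obtain ⟨-, ⟨e⟩⟩ := hT
  have hpc : PreconnectedSpace (Metric.ball (0 : ℂ) 1) :=
    isPreconnected_iff_preconnectedSpace.1 (convex_ball (0 : ℂ) 1).isPreconnected
  have : PreconnectedSpace (geomRealization T) :=
    e.symm.surjective.denseRange.preconnectedSpace e.symm.continuous
  have hne : Nonempty V :=
    ⟨(exists_pos T (e.symm ⟨0, Metric.mem_ball_self one_pos⟩)).choose⟩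
  have h := induce_preconnected_of_isPreconnected (T := T) (A := univ) isPreconnected_univ
    (isOpen_openStar T) (fun _ _ h => h)
    (fun x _ => mem_iUnion.2 (exists_pos T x))
  have hmem : ∀ v, v ∈ {v | (univ ∩ {x : geomRealization T | 0 < x.1 v}).Nonempty} := fun v =>
    ⟨vertexPoint T v, trivial, by simp [vertexPoint]⟩
  exact ⟨fun u v => (h ⟨u, hmem u⟩ ⟨v, hmem v⟩).map (SimpleGraph.Embedding.induce _).toHom⟩

/-! ### Locally finite patterns are parabolic -/

theorem area_const_mul (c : ℝ≥0) (η : V → ℝ≥0) :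
    area (fun v => c * η v) = (c : ℝ≥0∞) ^ 2 * area η := by
  simp [area, mul_pow, ENNReal.tsum_mul_left]

theorem length_const_mul (c : ℝ≥0) (η : V → ℝ≥0) (γ : Set V) :
    length (fun v => c * η v) γ = c * length η γ := by
  simp [length, ENNReal.tsum_mul_left]

theorem length_add (η η' : V → ℝ≥0) (γ : Set V) :
    length (fun v => η v + η' v) γ = length η γ + length η' γ := by
  simp [length, ENNReal.tsum_add]

theorem area_add {η η' : V → ℝ≥0} (h : ∀ v, η v = 0 ∨ η' v = 0) :
    area (fun v => η v + η' v) = area η + area η' := by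
  rw [area, area, area, ← ENNReal.tsum_add]
  refine tsum_congr fun v => ?_
  rcases h v with h | h <;> simp [h]

open MeasureTheory in
/-- The moduli of the circles around `p` that meet a disk. -/
theorem PlaneDisk.volume_dist_image_le (D : PlaneDisk) (p : ℂ) :
    volume ((dist · p) '' D.toSet) ≤ ENNReal.ofReal (2 * D.radius) := by
  calc volume ((dist · p) '' D.toSet)
      ≤ volume (Icc (dist D.center p - D.radius) (dist D.center p + D.radius)) := by
        refine measure_mono ?_
        rintro _ ⟨z, hz, rfl⟩
        have hz : dist z D.center ≤ D.radius := hz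
        have := abs_dist_sub_le z D.center p
        exact ⟨by linarith [(abs_le.1 this).1], by linarith [(abs_le.1 this).2]⟩
    _ = _ := by rw [Real.volume_Icc]; congr 1; ring

open Classical in
/-- The metric that assigns to each disk the relative width of the part of the annulus
`R < |z| < 2R` that it meets. -/
def annulusMetric (Q : DiskPattern V) (R : ℝ) (v : V) : ℝ≥0 :=
  if ((Q.disk v).toSet ∩ Metric.closedBall 0 (2 * R)).Nonempty ∧
      ¬ (Q.disk v).toSet ⊆ Metric.ball 0 R then
    (min (2 * (Q.disk v).radius) R / R).toNNReal else 0

theorem area_annulusMetric_le {Q : DiskPattern V} (hQ : Q.Nonobtuse) {R : ℝ} (hR : 0 < R) :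
    area (annulusMetric Q R) ≤ 256 := by
  set S := {v | ((Q.disk v).toSet ∩ Metric.closedBall 0 (2 * R)).Nonempty}
  have h1 : area (annulusMetric Q R) ≤
      ∑' v : S, ENNReal.ofReal (2 / R) ^ 2 * ENNReal.ofReal (min (Q.disk v).radius R) ^ 2 := by
    rw [tsum_subtype S fun v => ENNReal.ofReal (2 / R) ^ 2 *
      ENNReal.ofReal (min (Q.disk v).radius R) ^ 2]
    refine ENNReal.tsum_le_tsum fun v => ?_
    have hr := (Q.disk v).radius_pos
    unfold annulusMetric
    split_ifs with h
    · rw [indicator_of_mem (show v ∈ S from h.1), ← mul_pow, ← ENNReal.ofReal_mul (by positivity)]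
      refine pow_le_pow_left' (ENNReal.ofReal_le_ofReal ?_) 2
      rw [div_mul_eq_mul_div]
      refine div_le_div_of_nonneg_right ?_ hR.le
      rw [mul_min_of_nonneg _ _ zero_le_two]
      exact min_le_min le_rfl (by linarith)
    · simp
  rw [ENNReal.tsum_mul_left] at h1
  refine h1.trans ((mul_le_mul_right (hQ.tsum_sq_le 0 hR) _).trans ?_)
  rw [mul_left_comm, ← mul_pow, ← ENNReal.ofReal_mul (by positivity)]
  -- With multiplicity 4 this yields the constant `4 * 8 ^ 2 = 256`.
  have : 2 / R * (2 * R + 2 * R) = 8 := by field_simp; norm_num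
  rw [this]
  norm_num

open MeasureTheory in
-- The disks of the curve project by `|z|` onto a cover of the interval from `R` to `2R`.
-- Subadditivity of length, divided by `R`, gives the bound.
theorem one_le_length_annulusMetric {Q : DiskPattern V} [Countable V] {R : ℝ} (hR : 0 < R)
    {γ : Set V} (h : ∀ t ∈ Ioo R (2 * R), ∃ v ∈ γ, ∃ z ∈ (Q.disk v).toSet, dist z 0 = t) :
    1 ≤ length (annulusMetric Q R) γ := by
  have h1 : volume (Ioo R (2 * R)) ≤
      ∑' v : γ, volume (Ioo R (2 * R) ∩ (dist · 0) '' (Q.disk v).toSet) := by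
    refine (measure_mono ?_).trans (measure_iUnion_le _)
    intro t ht
    obtain ⟨v, hv, z, hz, hzt⟩ := h t ht
    exact mem_iUnion.2 ⟨⟨v, hv⟩, ht, z, hz, hzt⟩
  have h2 : ∀ v : γ, volume (Ioo R (2 * R) ∩ (dist · 0) '' (Q.disk v).toSet) ≤
      ENNReal.ofReal R * (annulusMetric Q R v : ℝ≥0∞) := by
    intro v
    have hr := (Q.disk v).radius_pos
    unfold annulusMetric
    split_ifs with hv
    · rw [← ENNReal.ofReal.eq_1, ← ENNReal.ofReal_mul hR.le, mul_div_cancel₀ _ hR.ne',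
        ENNReal.ofReal_min]
      refine le_min ((measure_mono inter_subset_right).trans
        ((Q.disk v).volume_dist_image_le 0)) ((measure_mono inter_subset_left).trans ?_)
      rw [Real.volume_Ioo]
      exact ENNReal.ofReal_le_ofReal (by linarith)
    · have : Ioo R (2 * R) ∩ (dist · 0) '' (Q.disk v).toSet = ∅ := by
        rw [eq_empty_iff_forall_notMem]
        rintro _ ⟨ht, z, hz, rfl⟩
        refine hv ⟨⟨z, hz, ht.2.le⟩, fun hsub => ?_⟩
        exact absurd (hsub hz) (not_lt.2 ht.1.le)
      rw [this, measure_empty]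
      exact zero_le
  have h3 := h1.trans (ENNReal.tsum_le_tsum h2)
  rw [ENNReal.tsum_mul_left, Real.volume_Ioo] at h3
  have e : 2 * R - R = R := by ring
  rw [e] at h3
  exact (ENNReal.mul_le_mul_iff_right (by simpa using hR) ENNReal.ofReal_ne_top).1
    ((mul_one _).trans_le h3)

/-- A chain of overlapping disks that starts inside `ball 0 t` and leaves it meets the circle of
radius `t`. -/
theorem exists_dist_eq_of_chain {Q : DiskPattern V} {p : ℕ → V}
    (hp : ∀ k, ((Q.disk (p k)).toSet ∩ (Q.disk (p (k + 1))).toSet).Nonempty) {t : ℝ}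
    (h0 : (Q.disk (p 0)).toSet ⊆ Metric.ball 0 t)
    (h1 : ∃ k, ¬ (Q.disk (p k)).toSet ⊆ Metric.ball 0 t) :
    ∃ v ∈ range p, ∃ z ∈ (Q.disk v).toSet, dist z 0 = t := by
  by_contra! hcon
  obtain ⟨k, hk⟩ := h1
  refine hk ?_
  clear hk
  induction k with
  | zero => exact h0
  | succ k ih =>
    obtain ⟨z, hz1, hz2⟩ := hp k
    intro w hw
    by_contra hwt
    have hc : IsPreconnected (Q.disk (p (k + 1))).toSet := (convex_closedBall _ _).isPreconnected
    obtain ⟨y, hy, hyt⟩ := hc.intermediate_value hz2 hw (f := (dist · 0))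
      (by fun_prop) ⟨(ih hz1 : dist z 0 < t).le, not_lt.1 hwt⟩
    exact hcon _ ⟨k + 1, rfl⟩ y hy hyt

theorem velParabolic_of_locallyFiniteIn {G : SimpleGraph V} (hG : G.Connected) {Q : DiskPattern V}
    (hQ : Q.Nonobtuse)
    (hadj : ∀ u v, G.Adj u v → ((Q.disk u).toSet ∩ (Q.disk v).toSet).Nonempty)
    (hlf : Q.LocallyFiniteIn univ) : VELParabolic G := by
  have := hQ.countable
  obtain ⟨v₀⟩ := hG.nonempty
  have hfin : ∀ R : ℝ, {v | ((Q.disk v).toSet ∩ Metric.closedBall 0 R).Nonempty}.Finite :=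
    fun R => hlf.2 _ (subset_univ _) (isCompact_closedBall 0 R)
  -- `R` is taken so large that the disks of `v₀` and `S` lie inside the annulus. The new metric
  -- then vanishes on `S`, and every infinite path from `v₀` crosses the annulus.
  have step : ∀ S : Set V, S.Finite → ∃ η : V → ℝ≥0, area η ≤ 256 ∧ {v | η v ≠ 0}.Finite ∧
      (∀ v ∈ S, η v = 0) ∧ ∀ γ ∈ curvesToInfinity G {v₀}, 1 ≤ length η γ := by
    intro S hS
    have hb : Bornology.IsBounded (⋃ v ∈ insert v₀ S, (Q.disk v).toSet) :=
      (Bornology.isBounded_biUnion (hS.insert v₀)).2 fun v _ => Metric.isBounded_closedBall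
    obtain ⟨R, hR0, hR⟩ := hb.subset_ball_lt 0 0
    have hR' : ∀ v ∈ insert v₀ S, (Q.disk v).toSet ⊆ Metric.ball 0 R := fun v hv =>
      (subset_biUnion_of_mem (u := fun v => (Q.disk v).toSet) hv).trans hR
    refine ⟨annulusMetric Q R, area_annulusMetric_le hQ hR0, (hfin (2 * R)).subset ?_, ?_, ?_⟩
    · intro v hv
      by_contra h
      exact hv (if_neg fun h' => h h'.1)
    · exact fun v hv => if_neg fun h' => h'.2 (hR' v (mem_insert_of_mem _ hv))
    · rintro _ ⟨p, hp0, hp, hinf, rfl⟩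
      refine one_le_length_annulusMetric hR0 fun t ht => ?_
      refine exists_dist_eq_of_chain (fun k => hadj _ _ (hp k)) ?_ ?_
      · rw [mem_singleton_iff.1 hp0]
        exact (hR' v₀ (mem_insert _ _)).trans (Metric.ball_subset_ball ht.1.le)
      · by_contra! hcon
        refine hinf ((hfin t).subset ?_)
        rintro _ ⟨k, rfl⟩
        have hc : (Q.disk (p k)).center ∈ (Q.disk (p k)).toSet :=
          Metric.mem_closedBall_self (Q.disk (p k)).radius_pos.le
        exact ⟨_, hc, Metric.ball_subset_closedBall (hcon k hc)⟩
  -- Disjoint supports make areas add without cross terms, so area grows like n while the squared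
  -- length grows like n².
  have main : ∀ n : ℕ, ∃ η : V → ℝ≥0, area η ≤ 256 * n ∧ {v | η v ≠ 0}.Finite ∧
      ∀ γ ∈ curvesToInfinity G {v₀}, n ≤ length η γ := by
    intro n
    induction n with
    | zero => exact ⟨0, by simp [area], by simp, by simp⟩
    | succ n ih =>
      obtain ⟨η, ha, hf, hl⟩ := ih
      obtain ⟨η', ha', hf', h0, hl'⟩ := step _ hf
      refine ⟨fun v => η v + η' v, ?_, (hf.union hf').subset ?_, ?_⟩
      · rw [area_add fun v => or_iff_not_imp_left.2 (h0 v)]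
        push_cast
        rw [mul_add, mul_one]
        exact add_le_add ha ha'
      · intro v hv
        by_contra h
        simp only [mem_union, mem_ofPred_eq, not_or, not_not] at h
        exact hv (by simp [h.1, h.2])
      · intro γ hγ
        rw [length_add]
        push_cast
        exact add_le_add (hl γ hγ) (hl' γ hγ)
  refine ⟨hG, {v₀}, finite_singleton _, singleton_nonempty _, ?_⟩
  rw [vertexExtremalLength, ENNReal.inv_eq_top]
  have hle : ∀ n : ℕ, vertexModulus (curvesToInfinity G {v₀}) ≤ 256 * ((n + 1 : ℕ) : ℝ≥0∞)⁻¹ := by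
    intro n
    obtain ⟨η, ha, -, hl⟩ := main (n + 1)
    have hn : ((n + 1 : ℕ) : ℝ≥0∞) ≠ 0 := by simp
    have hn' : ((n + 1 : ℕ) : ℝ≥0∞) ≠ ⊤ := ENNReal.natCast_ne_top _
    have hcoe : (((n + 1 : ℕ) : ℝ≥0)⁻¹ : ℝ≥0) = (((n + 1 : ℕ) : ℝ≥0∞)⁻¹ : ℝ≥0∞) := by
      rw [ENNReal.coe_inv (by simp)]
      simp
    refine (iInf₂_le (fun v => ((n + 1 : ℕ) : ℝ≥0)⁻¹ * η v) ?_).trans ?_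
    · intro γ hγ
      rw [length_const_mul, hcoe, ← ENNReal.inv_mul_cancel hn hn']
      exact mul_le_mul_right (hl γ hγ) _
    · rw [area_const_mul, hcoe]
      refine (mul_le_mul_right ha _).trans (le_of_eq ?_)
      rw [sq, mul_assoc, mul_left_comm _ 256, ENNReal.inv_mul_cancel hn hn', mul_one, mul_comm]
  have hlim : Tendsto (fun n : ℕ => 256 * ((n + 1 : ℕ) : ℝ≥0∞)⁻¹) atTop (𝓝 (256 * 0)) :=
    ENNReal.Tendsto.const_mul
      ((tendsto_add_atTop_iff_nat 1).2 ENNReal.tendsto_inv_nat_nhds_zero) (Or.inr (by simp))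
  rw [mul_zero] at hlim
  exact le_antisymm (ge_of_tendsto' hlim hle) zero_le

/-! ### Invariance of domain in the plane -/

/-- The exponential covers the punctured plane, so `f` lifts through it. -/
theorem exists_continuous_log {A : Type*} [TopologicalSpace A] [SimplyConnectedSpace A]
    [LocallyPathConnectedSpace A] {f : A → ℂ} (hf : Continuous f) (h0 : ∀ a, f a ≠ 0) :
    ∃ g : A → ℂ, Continuous g ∧ ∀ a, Complex.exp (g a) = f a := by
  obtain ⟨a₀⟩ : Nonempty A := inferInstance
  obtain ⟨g, ⟨-, hg⟩, -⟩ := Complex.isCoveringMapOn_exp.existsUnique_continuousMap_lifts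
    ⟨f, hf⟩ (a₀ := a₀) (Complex.exp_log (h0 a₀)) h0
  exact ⟨g, g.continuous, fun a => congrFun hg a⟩

/-- The function `z - p` has no continuous logarithm on a circle around `p`. -/
theorem not_exists_continuous_log_sphere {p : ℂ} {r : ℝ} (hr : 0 < r) {g : ℂ → ℂ}
    (hg : ContinuousOn g (Metric.sphere p r))
    (h : ∀ z ∈ Metric.sphere p r, Complex.exp (g z) = z - p) : False := by
  have hm : ∀ θ : ℝ, p + r * Complex.exp (θ * Complex.I) ∈ Metric.sphere p r := by
    intro θ
    rw [mem_sphere_iff_norm, add_sub_cancel_left, norm_mul, Complex.norm_exp_ofReal_mul_I,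
      Complex.norm_real, Real.norm_of_nonneg hr.le, mul_one]
  -- The difference is a logarithm of the constant `r`, hence constant, yet it changes by `-2πi`
  -- over a full turn.
  set k : ℝ → ℂ := fun θ => g (p + r * Complex.exp (θ * Complex.I)) - θ * Complex.I with hk
  have hkc : Continuous k := by
    refine Continuous.sub ?_ (by fun_prop)
    exact hg.comp_continuous (by fun_prop) hm
  have he : ∀ θ, Complex.exp (k θ) = r := by
    intro θ
    rw [hk]
    simp only
    rw [Complex.exp_sub, h _ (hm θ), add_sub_cancel_left,
      mul_div_assoc, div_self (Complex.exp_ne_zero _), mul_one]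
  have hconst := Complex.isCoveringMap_exp.const_of_comp hkc
    (fun a a' => Subtype.ext ((he a).trans (he a').symm)) 0 (2 * Real.pi)
  simp only [hk, Complex.ofReal_zero, zero_mul, Complex.exp_zero, mul_one, sub_zero,
    Complex.ofReal_mul, Complex.ofReal_ofNat, Complex.exp_two_pi_mul_I] at hconst
  exact Complex.two_pi_I_ne_zero (sub_eq_self.1 hconst.symm)

/-- A continuous map of the closed unit disk that is close to the identity on the unit circle has
a zero. -/
theorem exists_zero_of_near_id {f : ℂ → ℂ} (hf : ContinuousOn f (Metric.closedBall 0 1))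
    (h : ∀ z ∈ Metric.sphere (0 : ℂ) 1, ‖f z - z‖ < 1) :
    ∃ z ∈ Metric.closedBall (0 : ℂ) 1, f z = 0 := by
  by_contra! hne
  -- Radial retraction onto the closed disk; it makes `f` a nonvanishing map of the whole plane,
  -- which has a logarithm.
  set ρ : ℂ → ℂ := fun z => ((max 1 ‖z‖)⁻¹ : ℝ) * z with hρ
  have hmax : ∀ z : ℂ, 0 < max 1 ‖z‖ := fun z => lt_max_of_lt_left one_pos
  have hρc : Continuous ρ := by
    refine Continuous.mul (Complex.continuous_ofReal.comp ?_) continuous_id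
    exact Continuous.inv₀ (by fun_prop) fun z => (hmax z).ne'
  have hρm : ∀ z, ρ z ∈ Metric.closedBall (0 : ℂ) 1 := by
    intro z
    rw [mem_closedBall_zero_iff, hρ]
    simp only
    rw [norm_mul, Complex.norm_real, Real.norm_of_nonneg (inv_nonneg.2 (hmax z).le),
      inv_mul_le_one₀ (hmax z)]
    exact le_max_right _ _
  have hρs : ∀ z ∈ Metric.sphere (0 : ℂ) 1, ρ z = z := by
    intro z hz
    rw [mem_sphere_zero_iff_norm] at hz
    simp [hρ, hz]
  obtain ⟨g, hg, hge⟩ := exists_continuous_log (hf.comp_continuous hρc hρm) fun z => hne _ (hρm z)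
  have hs0 : ∀ z ∈ Metric.sphere (0 : ℂ) 1, z ≠ 0 := fun z hz h0 => by simp [h0] at hz
  have hslit : ∀ z ∈ Metric.sphere (0 : ℂ) 1, f z / z ∈ Complex.slitPlane := by
    intro z hz
    have e : f z / z = 1 + (f z - z) / z := by field_simp [hs0 z hz]; ring
    rw [e]
    refine Complex.mem_slitPlane_of_norm_lt_one ?_
    rw [norm_div, mem_sphere_zero_iff_norm.1 hz, div_one]
    exact h z hz
  refine not_exists_continuous_log_sphere (p := 0) one_pos
    -- Subtracting the principal logarithm of `f z / z`, which stays in the slit plane, would leave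
    -- a logarithm of `z` on the circle.
    (g := fun z => g z - Complex.log (f z / z)) ?_ ?_
  · refine hg.continuousOn.sub (ContinuousOn.clog ?_ hslit)
    exact (hf.mono Metric.sphere_subset_closedBall).div continuousOn_id hs0
  · intro z hz
    have h0 := hne z (Metric.sphere_subset_closedBall hz)
    rw [Complex.exp_sub, hge, Complex.exp_log (div_ne_zero h0 (hs0 z hz)), Function.comp_apply, hρs z hz,
      sub_zero, div_div_cancel₀ h0]

open MeasureTheory in
/-- Invariance of domain for the closed unit disk. A continuous left inverse `G` is composed with a
push away from a point `c` outside the image, after a perturbation of `G` that has no zero on a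
small circle around `c`. -/
theorem image_closedBall_mem_nhds {f : ℂ → ℂ} (hf : ContinuousOn f (Metric.closedBall 0 1))
    (hinj : InjOn f (Metric.closedBall 0 1)) : f '' Metric.closedBall 0 1 ∈ 𝓝 (f 0) := by
  set B := Metric.closedBall (0 : ℂ) 1
  have h0B : (0 : ℂ) ∈ B := Metric.mem_closedBall_self zero_le_one
  have hK : IsCompact (f '' B) := (isCompact_closedBall _ _).image_of_continuousOn hf
  by_contra hnot
  have hcB : CompactSpace B := isCompact_iff_compactSpace.1 (isCompact_closedBall _ _)
  -- Tietze extension of the inverse of `f`.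
  obtain ⟨G, hG⟩ := ContinuousMap.exists_extension'
    (e := B.domRestrict f) ((continuousOn_iff_continuous_domRestrict.1 hf).isClosedEmbedding
      (injOn_iff_injective.1 hinj)) ⟨Subtype.val, continuous_subtype_val⟩
  have hGf : ∀ z ∈ B, G (f z) = z := fun z hz => congrFun hG ⟨z, hz⟩
  have hS : IsClosed (f '' Metric.sphere 0 1) := ((isCompact_sphere 0 1).image_of_continuousOn
    (hf.mono Metric.sphere_subset_closedBall)).isClosed
  have h0S : f 0 ∉ f '' Metric.sphere 0 1 := by
    rintro ⟨z, hz, hz0⟩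
    have := hinj (Metric.sphere_subset_closedBall hz) h0B hz0
    simp [this] at hz
  obtain ⟨δ, hδ, hball⟩ := Metric.isOpen_iff.1 hS.isOpen_compl (f 0) h0S
  obtain ⟨c, hc, hcK⟩ : ∃ c ∈ Metric.ball (f 0) (δ / 2), c ∉ f '' B := by
    by_contra! hcon
    exact hnot (mem_of_superset (Metric.ball_mem_nhds _ (half_pos hδ)) hcon)
  set ε := δ / 2
  have hε : 0 < ε := half_pos hδ
  have hcf : dist c (f 0) < ε := hc
  have hfar : ∀ z ∈ Metric.sphere (0 : ℂ) 1, ε ≤ dist (f z) c := by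
    intro z hz
    have : ¬ dist (f z) (f 0) < δ := fun hlt => hball hlt ⟨z, hz, rfl⟩
    have h2 : δ = ε + ε := (add_halves δ).symm
    linarith [dist_triangle (f z) c (f 0)]
  have hK1 : IsCompact (f '' B ∩ {y | ε ≤ dist y c}) :=
    hK.inter_right (isClosed_le continuous_const (by fun_prop))
  have h1s : (1 : ℂ) ∈ Metric.sphere (0 : ℂ) 1 := by simp
  obtain ⟨y₀, hy₀, hmin⟩ := hK1.exists_isMinOn
    ⟨f 1, mem_image_of_mem f (Metric.sphere_subset_closedBall h1s), hfar 1 h1s⟩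
    (f := fun y => ‖G y‖) (by fun_prop)
  have hm : 0 < ‖G y₀‖ := by
    obtain ⟨⟨z, hz, rfl⟩, hzc⟩ := hy₀
    rw [hGf z hz, norm_pos_iff]
    rintro rfl
    have hzc : ε ≤ dist (f 0) c := hzc
    rw [dist_comm] at hcf
    linarith
  have hmin' : ∀ y ∈ f '' B, ε ≤ dist y c → ‖G y₀‖ ≤ ‖G y‖ := fun y h1 h2 => hmin ⟨h1, h2⟩
  -- The error made below is less than `2 * m`: too small to create a zero away from `c`, where `‖G‖
  -- ≥ 4 * m`, or to reach 1 on the unit circle.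
  set m := min ‖G y₀‖ 1 / 4 with hmdef
  have hmpos : 0 < m := by positivity
  have hm1 : 4 * m ≤ ‖G y₀‖ := by rw [hmdef]; linarith [min_le_left ‖G y₀‖ 1]
  have hm2 : 4 * m ≤ 1 := by rw [hmdef]; linarith [min_le_right ‖G y₀‖ 1]
  -- A differentiable approximation sends the circle around `c` to a null set, so a small
  -- translation `w` moves its image off zero.
  obtain ⟨H, hH, hHG, -⟩ := G.continuous.exists_contDiff_approx 1 (ε := fun _ => m)
    continuous_const fun _ => hmpos
  have hnull : volume (H '' Metric.sphere c ε) = 0 :=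
    addHaar_image_eq_zero_of_differentiableOn_of_addHaar_eq_zero _
      (hH.differentiable (by simp)).differentiableOn (Measure.addHaar_sphere _ _ _)
  obtain ⟨w, hw, hwH⟩ : ∃ w ∈ Metric.ball (0 : ℂ) m, w ∉ H '' Metric.sphere c ε := by
    by_contra! hcon
    exact (Metric.measure_ball_pos volume (0 : ℂ) hmpos).ne' (measure_mono_null hcon hnull)
  rw [mem_ball_zero_iff] at hw
  have hyc : ∀ y ∈ f '' B, 0 < ‖y - c‖ := fun y hy =>
    norm_pos_iff.2 (sub_ne_zero.2 fun h => hcK (h ▸ hy))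
  -- Points closer to `c` than `ε` are pushed radially onto the circle of radius `ε`; the others are
  -- fixed.
  set Φ : ℂ → ℂ := fun y => c + (max 1 (ε / ‖y - c‖) : ℝ) * (y - c) with hΦ
  have hΦc : ContinuousOn Φ (f '' B) := by
    have : ContinuousOn (fun y => max 1 (ε / ‖y - c‖)) (f '' B) :=
      continuousOn_const.sup (continuousOn_const.div (by fun_prop) fun y hy => (hyc y hy).ne')
    exact continuousOn_const.add ((Complex.continuous_ofReal.comp_continuousOn this).mul
      (by fun_prop))
  have hΦ1 : ∀ y ∈ f '' B, ε ≤ dist y c → Φ y = y := by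
    intro y hy h
    rw [dist_eq_norm] at h
    rw [hΦ]
    simp only
    rw [max_eq_left ((div_le_one (hyc y hy)).2 h)]
    simp
  have hΦ2 : ∀ y ∈ f '' B, dist y c < ε → Φ y ∈ Metric.sphere c ε := by
    intro y hy h
    rw [dist_eq_norm] at h
    rw [hΦ, mem_sphere_iff_norm]
    simp only
    rw [add_sub_cancel_left, max_eq_right ((one_le_div (hyc y hy)).2 h.le), norm_mul,
      Complex.norm_real, Real.norm_of_nonneg (by positivity), div_mul_cancel₀ _ (hyc y hy).ne']
  have hclose : ∀ y, ‖H y - w - G y‖ < 2 * m := by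
    intro y
    have h1 := hHG y
    rw [dist_eq_norm] at h1
    have e : H y - w - G y = (H y - G y) - w := by ring
    rw [e]
    linarith [norm_sub_le (H y - G y) w]
  obtain ⟨z, hz, hz0⟩ := exists_zero_of_near_id (f := fun z => H (Φ (f z)) - w)
    ((hH.continuous.comp_continuousOn (hΦc.comp hf (mapsTo_image f B))).sub continuousOn_const) (by
      intro z hz
      have hzB := Metric.sphere_subset_closedBall hz
      rw [hΦ1 _ (mem_image_of_mem f hzB) (hfar z hz)]
      have := hclose (f z)
      rw [hGf z hzB] at this
      linarith)
  have hy := mem_image_of_mem f hz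
  rcases lt_or_ge (dist (f z) c) ε with h | h
  · exact hwH ⟨_, hΦ2 _ hy h, sub_eq_zero.1 hz0⟩
  · rw [hΦ1 _ hy h] at hz0
    have h1 := hclose (f z)
    rw [hz0, zero_sub, norm_neg] at h1
    linarith [hmin' _ hy h]

/-- Invariance of domain in the plane, for locally injective maps. -/
theorem isOpenMap_of_isLocallyInjective {U : Set ℂ} (hU : IsOpen U) {f : U → ℂ}
    (hf : Continuous f) (hinj : IsLocallyInjective f) : IsOpenMap f := by
  refine IsOpenMap.of_nhds_le fun x => ?_
  intro s hs
  rw [mem_map] at hs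
  obtain ⟨W, hW, hxW, hWinj⟩ := hinj x
  have hN : Subtype.val '' (f ⁻¹' s ∩ W) ∈ 𝓝 (x : ℂ) :=
    hU.isOpenEmbedding_subtypeVal.image_mem_nhds.2 (inter_mem hs (hW.mem_nhds hxW))
  obtain ⟨r, hr, hball⟩ := Metric.nhds_basis_closedBall.mem_iff.1 hN
  set F : ℂ → ℂ := Function.extend Subtype.val f 0 with hF
  have hFU : ∀ z (hz : z ∈ U), F z = f ⟨z, hz⟩ := fun z hz =>
    Subtype.val_injective.extend_apply f 0 ⟨z, hz⟩
  have hFc : ContinuousOn F U := by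
    rw [continuousOn_iff_continuous_domRestrict]
    convert hf using 1
    exact funext fun z => hFU z z.2
  have hm : ∀ z ∈ Metric.closedBall (0 : ℂ) 1,
      ∃ h : (x : ℂ) + r * z ∈ U, f ⟨_, h⟩ ∈ s ∧ (⟨_, h⟩ : U) ∈ W := by
    intro z hz
    have : (x : ℂ) + r * z ∈ Metric.closedBall (x : ℂ) r := by
      rw [mem_closedBall_iff_norm, add_sub_cancel_left, norm_mul, Complex.norm_real,
        Real.norm_of_nonneg hr.le]
      exact mul_le_of_le_one_right hr.le (mem_closedBall_zero_iff.1 hz)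
    obtain ⟨y, ⟨hy1, hy2⟩, hy⟩ := hball this
    rw [← hy]
    exact ⟨y.2, hy1, hy2⟩
  have h1 := image_closedBall_mem_nhds (f := fun z => F (x + r * z))
    (hFc.comp (by fun_prop) fun z hz => (hm z hz).1) (by
      intro z hz w hw hzw
      obtain ⟨a1, -, a3⟩ := hm z hz
      obtain ⟨b1, -, b3⟩ := hm w hw
      simp only [hFU _ a1, hFU _ b1] at hzw
      have := congrArg Subtype.val (hWinj a3 b3 hzw)
      simpa [hr.ne'] using this)
  simp only [mul_zero, add_zero, hFU _ x.2] at h1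
  refine mem_of_superset h1 ?_
  rintro _ ⟨z, hz, rfl⟩
  obtain ⟨a1, a2, -⟩ := hm z hz
  simpa only [hFU _ a1] using a2

/-! ### The topology of the realization and of the center map -/

theorem sum_eq_one_of_carried {T : AbstractSimplicialComplex V} (x : geomRealization T)
    {s : Finset V} (hs : ∀ v ∉ s, x.1 v = 0) : ∑ v ∈ s, x.1 v = 1 := by
  classical
  obtain ⟨-, t, -, ht, hsum⟩ := x.2
  rw [← hsum, Finset.sum_subset (Finset.subset_union_left (s₂ := t)) fun v _ h => hs v h,
    Finset.sum_subset (Finset.subset_union_right (s₁ := s)) fun v _ h => ht v h]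

theorem carrier_mem_faces {T : AbstractSimplicialComplex V} (x : geomRealization T) :
    ∃ s ∈ T.faces, (∀ v ∉ s, x.1 v = 0) ∧ ∀ v ∈ s, 0 < x.1 v := by
  classical
  obtain ⟨hnn, s, hs, hsupp, hsum⟩ := x.2
  refine ⟨s.filter fun v => 0 < x.1 v, ?_, ?_, fun v hv => (Finset.mem_filter.1 hv).2⟩
  · refine (T.isRelLowerSet_faces hs).2 (Finset.filter_subset _ _) ?_
    obtain ⟨v, hv⟩ := exists_pos T x
    exact ⟨v, Finset.mem_filter.2 ⟨by_contra fun h => hv.ne' (hsupp v h), hv⟩⟩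
  · intro v hv
    by_cases h : v ∈ s
    · exact le_antisymm (not_lt.1 fun h' => hv (Finset.mem_filter.2 ⟨h, h'⟩)) (hnn v)
    · exact hsupp v h

theorem combo_mem_geomRealization {T : AbstractSimplicialComplex V} {s : Finset V}
    (hs : s ∈ T.faces) (x y : geomRealization T) (hx : ∀ v ∉ s, x.1 v = 0)
    (hy : ∀ v ∉ s, y.1 v = 0) {t : ℝ} (ht : t ∈ Icc (0 : ℝ) 1) :
    (1 - t) • x.1 + t • y.1 ∈ geomRealization T := by
  refine ⟨fun v => ?_, s, hs, fun v hv => by simp [hx v hv, hy v hv], ?_⟩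
  · have h1 : 0 ≤ 1 - t := by linarith [ht.2]
    exact add_nonneg (mul_nonneg h1 (x.2.1 v)) (mul_nonneg ht.1 (y.2.1 v))
  · simp only [Pi.add_apply, Pi.smul_apply, smul_eq_mul, Finset.sum_add_distrib,
      ← Finset.mul_sum, sum_eq_one_of_carried x hx, sum_eq_one_of_carried y hy]
    ring

theorem vertexPoint_apply_ne (T : AbstractSimplicialComplex V) {v w : V} (h : w ≠ v) :
    (vertexPoint T v).1 w = 0 := by
  classical
  simp [vertexPoint, h]

theorem vertexPoint_apply_self (T : AbstractSimplicialComplex V) (v : V) :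
    (vertexPoint T v).1 v = 1 := by
  classical
  simp [vertexPoint]

theorem vertexPoint_carried (T : AbstractSimplicialComplex V) {v : V} {s : Finset V} (hv : v ∈ s) :
    ∀ w ∉ s, (vertexPoint T v).1 w = 0 := fun _ hw =>
  vertexPoint_apply_ne T fun h => hw (h ▸ hv)

theorem pair_mem_faces [DecidableEq V] {T : AbstractSimplicialComplex V} {u v : V}
    (h : (oneSkeleton T).Adj u v) : {u, v} ∈ T.faces := by
  obtain ⟨-, s, hs, hu, hv⟩ := h
  exact (T.isRelLowerSet_faces hs).2 (by simp [Finset.insert_subset_iff, hu, hv])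
    (Finset.insert_nonempty _ _)

/-- In a triangulation of the disk every vertex has finite degree. -/
theorem finite_setOf_adj {T : AbstractSimplicialComplex V} (hT : IsOpenDiskTriangulation T) (v : V) :
    {w | (oneSkeleton T).Adj v w}.Finite := by
  classical
  obtain ⟨-, ⟨e⟩⟩ := hT
  have : LocallyCompactSpace (Metric.ball (0 : ℂ) 1) := Metric.isOpen_ball.locallyCompactSpace
  have : LocallyCompactSpace (geomRealization T) := e.isClosedEmbedding.locallyCompactSpace
  obtain ⟨K, hK, hKv⟩ := exists_compact_mem_nhds (vertexPoint T v)
  obtain ⟨N, hN, hNK⟩ := mem_nhds_subtype _ _ _ |>.1 hKv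
  have hKc : IsClosed (Subtype.val '' K : Set (V → ℝ)) :=
    (hK.image continuous_subtype_val).isClosed
  by_contra hinf
  have hl : Tendsto (fun t : ℝ => (1 - t) • (vertexPoint T v).1) (𝓝 0)
      (𝓝 (vertexPoint T v).1) := by
    have : Continuous fun t : ℝ => (1 - t) • (vertexPoint T v).1 := by fun_prop
    simpa using this.tendsto 0
  obtain ⟨t, htN, ht0, ht1⟩ : ∃ t : ℝ, (1 - t) • (vertexPoint T v).1 ∈ interior N ∧ 0 < t ∧ t < 1 := by
    have h1 := (hl.eventually (isOpen_interior.mem_nhds (mem_interior_iff_mem_nhds.2 hN))).filter_mono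
      (nhdsWithin_le_nhds (s := Ioi 0))
    obtain ⟨t, h2, h3⟩ := (h1.and (Ioo_mem_nhdsGT (one_pos : (0 : ℝ) < 1))).exists
    exact ⟨t, h2, h3⟩
  -- With infinitely many neighbors `w`, the points at ratio `t` on the edges `[v, w]` would
  -- accumulate at a function of total mass `1 - t`. It lies outside the realization, contrary to
  -- local compactness.
  have hlim : Tendsto (fun w => (1 - t) • (vertexPoint T v).1 + t • (vertexPoint T w).1) cofinite
      (𝓝 ((1 - t) • (vertexPoint T v).1)) := by
    rw [tendsto_pi_nhds]
    intro u
    refine tendsto_const_nhds.congr' ?_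
    filter_upwards [(finite_singleton u).compl_mem_cofinite] with w hw
    simp [vertexPoint_apply_ne T (fun h => hw h.symm : u ≠ w)]
  have hfreq : ∃ᶠ w in cofinite, (1 - t) • (vertexPoint T v).1 + t • (vertexPoint T w).1 ∈
      (Subtype.val '' K : Set (V → ℝ)) := by
    have h1 : ∃ᶠ w in cofinite, (oneSkeleton T).Adj v w := frequently_cofinite_iff_infinite.2 hinf
    refine (h1.and_eventually (hlim.eventually (isOpen_interior.mem_nhds htN))).mono ?_
    rintro w ⟨hw, hwN⟩
    have hm := combo_mem_geomRealization (pair_mem_faces hw) (vertexPoint T v) (vertexPoint T w)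
      (vertexPoint_carried T (by simp)) (vertexPoint_carried T (by simp)) ⟨ht0.le, ht1.le⟩
    exact ⟨⟨_, hm⟩, hNK (show _ ∈ N from interior_subset (s := N) hwN), rfl⟩
  obtain ⟨x, -, hx⟩ : (1 - t) • (vertexPoint T v).1 ∈ (Subtype.val '' K : Set (V → ℝ)) :=
    hKc.mem_of_frequently_of_tendsto hfreq hlim
  have := sum_eq_one_of_carried x (s := {v}) fun w hw => by
    rw [hx]
    simp [vertexPoint_apply_ne T (by simpa using hw : w ≠ v)]
  rw [hx] at this
  simp [vertexPoint_apply_self] at this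
  exact ht0.ne' this

section CenterMap

variable {T : AbstractSimplicialComplex V} {Q : DiskPattern V}

theorem DiskPattern.centerMap_eq_sum (Q : DiskPattern V) (x : geomRealization T) {s : Finset V}
    (hs : ∀ v ∉ s, x.1 v = 0) : Q.centerMap T x = ∑ v ∈ s, x.1 v • (Q.disk v).center := by
  refine finsum_eq_sum_of_support_subset _ fun v hv => ?_
  by_contra h
  exact hv (by simp [hs v h])

theorem DiskPattern.centerMap_vertexPoint (Q : DiskPattern V) (v : V) :
    Q.centerMap T (vertexPoint T v) = (Q.disk v).center := by
  rw [Q.centerMap_eq_sum _ (vertexPoint_carried T (Finset.mem_singleton_self v))]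
  simp [vertexPoint_apply_self]

theorem DiskPattern.centerMap_combo (Q : DiskPattern V) {s : Finset V}
    (hs : s ∈ T.faces) (x y : geomRealization T) (hx : ∀ v ∉ s, x.1 v = 0)
    (hy : ∀ v ∉ s, y.1 v = 0) {t : ℝ} (ht : t ∈ Icc (0 : ℝ) 1) :
    Q.centerMap T ⟨_, combo_mem_geomRealization hs x y hx hy ht⟩ =
      (1 - t) • Q.centerMap T x + t • Q.centerMap T y := by
  rw [Q.centerMap_eq_sum x hx, Q.centerMap_eq_sum y hy, Q.centerMap_eq_sum _ (s := s)
    fun v hv => by simp [hx v hv, hy v hv]]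
  simp only [Pi.add_apply, Pi.smul_apply, smul_eq_mul, add_smul, Finset.sum_add_distrib,
    Finset.smul_sum, mul_smul]

/-- On an open star only the finitely many neighbors of its vertex can carry weight besides the
vertex itself, so the sum has a fixed finite range. -/
theorem DiskPattern.continuous_centerMap (Q : DiskPattern V) (hT : IsOpenDiskTriangulation T) :
    Continuous (Q.centerMap T) := by
  classical
  rw [continuous_iff_continuousAt]
  intro x
  obtain ⟨v, hv⟩ := exists_pos T x
  set N := insert v (finite_setOf_adj hT v).toFinset
  have heq : ∀ y : geomRealization T, 0 < y.1 v →
      Q.centerMap T y = ∑ w ∈ N, y.1 w • (Q.disk w).center := by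
    intro y hy
    refine Q.centerMap_eq_sum y fun w hw => ?_
    by_contra h
    have hpos := lt_of_le_of_ne (y.2.1 w) (Ne.symm h)
    refine hw ?_
    by_cases hvw : w = v
    · simp [N, hvw]
    · simp [N, oneSkeleton_adj_of_pos y hy hpos (Ne.symm hvw)]
  have hc : Continuous fun y : geomRealization T => ∑ w ∈ N, y.1 w • (Q.disk w).center :=
    continuous_finsetSum _ fun w _ =>
      ((continuous_apply w).comp continuous_subtype_val).smul continuous_const
  refine hc.continuousAt.congr ?_
  filter_upwards [(isOpen_openStar T v).mem_nhds hv] with y hy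
  exact (heq y hy).symm

theorem DiskPattern.IsImmersed.isOpenMap (himm : Q.IsImmersed T)
    (hT : IsOpenDiskTriangulation T) : IsOpenMap (Q.centerMap T) := by
  obtain ⟨e⟩ := hT.2
  have h := isOpenMap_of_isLocallyInjective Metric.isOpen_ball
    (f := Q.centerMap T ∘ e.symm) ((Q.continuous_centerMap hT).comp e.symm.continuous) (by
      intro x
      obtain ⟨U, hU, hxU, hinj⟩ := himm (e.symm x)
      exact ⟨e.symm ⁻¹' U, hU.preimage e.symm.continuous, hxU, fun a ha b hb hab =>
        e.symm.injective (hinj ha hb hab)⟩)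
  have h2 := h.comp e.isOpenMap
  simpa [Function.comp_assoc] using h2

/-- The center map is injective on closed stars. -/
theorem DiskPattern.IsImmersed.eq_of_mem_star (himm : Q.IsImmersed T) {a : V} {s t : Finset V}
    (hs : s ∈ T.faces) (ht : t ∈ T.faces) (has : a ∈ s) (hat : a ∈ t) {x y : geomRealization T}
    (hx : ∀ v ∉ s, x.1 v = 0) (hy : ∀ v ∉ t, y.1 v = 0)
    (hxy : Q.centerMap T x = Q.centerMap T y) : x = y := by
  obtain ⟨U, hU, haU, hinj⟩ := himm (vertexPoint T a)
  obtain ⟨N, hN, hNU⟩ := (mem_nhds_subtype _ _ _).1 (hU.mem_nhds haU)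
  -- Shrinking toward `a` brings both points into the neighborhood of injectivity; the center map is
  -- affine on each face and respects the shrinking.
  have hl : ∀ z : geomRealization T, ∀ᶠ τ : ℝ in 𝓝[>] 0,
      (1 - τ) • (vertexPoint T a).1 + τ • z.1 ∈ N := by
    intro z
    have hc : Continuous fun τ : ℝ => (1 - τ) • (vertexPoint T a).1 + τ • z.1 := by fun_prop
    have := hc.tendsto 0
    simp only [sub_zero, one_smul, zero_smul, add_zero] at this
    exact (this.eventually hN).filter_mono nhdsWithin_le_nhds
  obtain ⟨τ, ⟨h1, h2⟩, h3⟩ := (((hl x).and (hl y)).and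
    (Ioo_mem_nhdsGT (one_pos : (0 : ℝ) < 1))).exists
  have hτ : τ ∈ Icc (0 : ℝ) 1 := ⟨h3.1.le, h3.2.le⟩
  have hx' := Q.centerMap_combo hs (vertexPoint T a) x (vertexPoint_carried T has) hx hτ
  have hy' := Q.centerMap_combo ht (vertexPoint T a) y (vertexPoint_carried T hat) hy hτ
  have := hinj (hNU h1) (hNU h2) (hx'.trans (by rw [hy', hxy]))
  have := congrArg Subtype.val this
  refine Subtype.ext (funext fun v => ?_)
  have := congrFun this v
  simpa [h3.1.ne'] using this

/-- The closed triangle (segment, point) spanned by the centers of the disks of a face. -/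
def DiskPattern.hull (Q : DiskPattern V) (s : Finset V) : Set ℂ :=
  convexHull ℝ ((fun v => (Q.disk v).center) '' s)

theorem DiskPattern.center_mem_hull (Q : DiskPattern V) {s : Finset V} {v : V} (hv : v ∈ s) :
    (Q.disk v).center ∈ Q.hull s :=
  subset_convexHull _ _ (mem_image_of_mem _ hv)

theorem DiskPattern.isClosed_hull (Q : DiskPattern V) (s : Finset V) : IsClosed (Q.hull s) :=
  (s.finite_toSet.image _).isClosed_convexHull _

theorem DiskPattern.centerMap_mem_hull (Q : DiskPattern V) (x : geomRealization T) {s : Finset V}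
    (hs : ∀ v ∉ s, x.1 v = 0) : Q.centerMap T x ∈ Q.hull s := by
  rw [Q.centerMap_eq_sum x hs]
  exact (convex_convexHull ℝ _).sum_mem (fun v _ => x.2.1 v) (sum_eq_one_of_carried x hs)
    fun v hv => Q.center_mem_hull hv

theorem DiskPattern.exists_centerMap_eq_of_mem_hull (Q : DiskPattern V) {s : Finset V}
    (hs : s ∈ T.faces) {z : ℂ} (hz : z ∈ Q.hull s) :
    ∃ x : geomRealization T, (∀ v ∉ s, x.1 v = 0) ∧ Q.centerMap T x = z := by
  have hc : Convex ℝ (Q.centerMap T '' {x | ∀ v ∉ s, x.1 v = 0}) := by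
    rintro _ ⟨x, hx, rfl⟩ _ ⟨y, hy, rfl⟩ a b ha hb hab
    have hb1 : b ∈ Icc (0 : ℝ) 1 := ⟨hb, by linarith⟩
    refine ⟨_, fun v hv => ?_, (Q.centerMap_combo hs x y hx hy hb1).trans ?_⟩
    · simp [hx v hv, hy v hv]
    · rw [show 1 - b = a by linarith]
  obtain ⟨x, hx, hxz⟩ := convexHull_min (s := (fun v => (Q.disk v).center) '' s) (by
    rintro _ ⟨v, hv, rfl⟩
    exact ⟨vertexPoint T v, vertexPoint_carried T hv, Q.centerMap_vertexPoint v⟩) hc hz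
  exact ⟨x, hx, hxz⟩

theorem DiskPattern.exists_mem_segment_of_card_lt (Q : DiskPattern V) (x : geomRealization T)
    {t : Finset V} (ht : t ∈ T.faces) (hcard : t.card < 3) (htx : ∀ v ∉ t, x.1 v = 0) :
    ∃ a ∈ t, ∃ b ∈ t, Q.centerMap T x ∈ segment ℝ (Q.disk a).center (Q.disk b).center := by
  classical
  have hne : t.Nonempty := (T.isRelLowerSet_faces ht).1
  have hmem := Q.centerMap_mem_hull x htx
  obtain h1 | h2 : t.card = 1 ∨ t.card = 2 := by have := hne.card_pos; omega
  · obtain ⟨a, rfl⟩ := Finset.card_eq_one.1 h1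
    refine ⟨a, by simp, a, by simp, ?_⟩
    simpa [DiskPattern.hull] using hmem
  · obtain ⟨a, b, -, rfl⟩ := Finset.card_eq_two.1 h2
    refine ⟨a, by simp, b, by simp, ?_⟩
    simpa [DiskPattern.hull, image_pair, convexHull_pair] using hmem

/-- A segment that leaves the triangle of a face crosses one of its edges. -/
theorem DiskPattern.IsImmersed.exists_mem_segment (himm : Q.IsImmersed T)
    (hT : IsOpenDiskTriangulation T) {s : Finset V} (hs : s ∈ T.faces) {z y : ℂ}
    (hz : z ∈ Q.hull s) (hy : y ∉ Q.hull s) :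
    ∃ w ∈ segment ℝ z y, w ∈ Q.hull s ∧ ∃ a ∈ s, ∃ b ∈ s,
      w ∈ segment ℝ (Q.disk a).center (Q.disk b).center := by
  classical
  obtain ⟨w, hw, hwh, hwf⟩ : ∃ w ∈ segment ℝ z y, w ∈ Q.hull s ∧ w ∉ interior (Q.hull s) := by
    by_contra! hcon
    obtain ⟨w, -, hw1, hw2⟩ := (convex_segment z y).isPreconnected (interior (Q.hull s))
      (Q.hull s)ᶜ isOpen_interior (Q.isClosed_hull s).isOpen_compl
      (fun w hw => (em (w ∈ Q.hull s)).imp (hcon w hw) id)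
      ⟨z, left_mem_segment ℝ z y, hcon z (left_mem_segment ℝ z y) hz⟩
      ⟨y, right_mem_segment ℝ z y, hy⟩
    exact hw2 (interior_subset hw1)
  refine ⟨w, hw, hwh, ?_⟩
  obtain ⟨x, hx, rfl⟩ := Q.exists_centerMap_eq_of_mem_hull hs hwh
  obtain ⟨t, ht, htx, htpos⟩ := carrier_mem_faces x
  have hts : t ⊆ s := fun v hv => by_contra fun h => (htpos v hv).ne' (hx v h)
  have hle := hT.1 t ht
  -- If all three weights were positive, the openness of the center map would place `w` in the
  -- interior of the triangle.
  have hlt : t.card < 3 := by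
    by_contra hge
    have hts' : t = s := Finset.eq_of_subset_of_card_le hts (by have := hT.1 s hs; omega)
    subst hts'
    have hopen : IsOpen {y : geomRealization T | ∀ v ∈ t, 0 < y.1 v} := by
      have : {y : geomRealization T | ∀ v ∈ t, 0 < y.1 v} =
          ⋂ v ∈ t, {y : geomRealization T | 0 < y.1 v} := by ext; simp
      rw [this]
      exact isOpen_biInter_finset fun v _ => isOpen_openStar T v
    refine hwf (mem_interior.2 ⟨_, ?_, himm.isOpenMap hT _ hopen, ⟨x, htpos, rfl⟩⟩)
    rintro _ ⟨y, hy, rfl⟩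
    refine Q.centerMap_mem_hull y ?_
    obtain ⟨u, hu, huy, hupos⟩ := carrier_mem_faces y
    have htu : t ⊆ u := fun v hv => by_contra fun h => (hy v hv).ne' (huy v h)
    have : t = u := Finset.eq_of_subset_of_card_le htu (by have := hT.1 u hu; omega)
    exact this ▸ huy
  obtain ⟨a, ha, b, hb, hab⟩ := Q.exists_mem_segment_of_card_lt x ht hlt htx
  exact ⟨a, hts ha, b, hts hb, hab⟩

end CenterMap

/-! ### The center map of an immersed pattern is injective -/

/-- The metric consequences of the fact that `Q` realizes some nonobtuse angles on `G`: any two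
disks are nonobtuse, adjacent disks overlap, and orthogonal disks are adjacent. -/
structure DiskPattern.Fits (Q : DiskPattern V) (G : SimpleGraph V) : Prop where
  nonobtuse : Q.Nonobtuse
  dist_le : ∀ {u v}, G.Adj u v →
    dist (Q.disk u).center (Q.disk v).center ≤ (Q.disk u).radius + (Q.disk v).radius
  adj_of_dist_sq_eq : ∀ {u v}, u ≠ v → dist (Q.disk u).center (Q.disk v).center ^ 2 =
    (Q.disk u).radius ^ 2 + (Q.disk v).radius ^ 2 → G.Adj u v

theorem DiskPattern.Realizes.fits {G : SimpleGraph V} {Θ : G.edgeSet → ℝ} {Q : DiskPattern V}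
    (hQ : Q.Realizes Θ) (hΘ : ∀ e, Θ e ∈ Set.Icc 0 (Real.pi / 2)) : Q.Fits G :=
  ⟨hQ.nonobtuse hΘ, hQ.dist_le, hQ.adj_of_dist_sq_eq⟩

section Injective

variable {T : AbstractSimplicialComplex V} {Q : DiskPattern V}

theorem DiskPattern.Fits.dist_le_of_mem (hQ : Q.Fits (oneSkeleton T)) {s : Finset V}
    (hs : s ∈ T.faces) {a b : V} (ha : a ∈ s) (hb : b ∈ s) :
    dist (Q.disk a).center (Q.disk b).center ≤ (Q.disk a).radius + (Q.disk b).radius := by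
  by_cases h : a = b
  · subst h
    rw [dist_self]
    linarith [(Q.disk a).radius_pos]
  · exact hQ.dist_le ⟨h, s, hs, ha, hb⟩

theorem DiskPattern.Fits.center_notMem_segment (hQ : Q.Fits (oneSkeleton T)) {s : Finset V}
    (hs : s ∈ T.faces) {a b d : V} (ha : a ∈ s) (hb : b ∈ s) (hd : d ∉ s) :
    (Q.disk d).center ∉ segment ℝ (Q.disk a).center (Q.disk b).center := by
  rw [segment_eq_image]
  rintro ⟨t, ht, h⟩
  exact HePattern.center_notMem_segment (Q.disk d).radius_pos ht h (hQ.dist_le_of_mem hs ha hb)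
    (hQ.nonobtuse a d fun h => hd (h ▸ ha)) (hQ.nonobtuse b d fun h => hd (h ▸ hb))

/-- The equality case of `crossing_segments` fixes the crossing point on `[d, e]` and makes the
disks of `a` and `d` orthogonal. The positive radii rule out the far endpoints, where the
coefficients would vanish. -/
theorem DiskPattern.Fits.crossing (hQ : Q.Fits (oneSkeleton T)) {s : Finset V}
    (hs : s ∈ T.faces) {a b d e : V} (ha : a ∈ s) (hb : b ∈ s) (hd : d ∉ s) (he : e ∉ s)
    (hde : (oneSkeleton T).Adj d e) {t : ℝ} (ht : t ∈ Icc (0 : ℝ) 1)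
    (h : (1 - t) • (Q.disk d).center + t • (Q.disk e).center ∈
      segment ℝ (Q.disk a).center (Q.disk b).center) :
    (1 - t) * (Q.disk d).radius = t * (Q.disk e).radius ∧ (oneSkeleton T).Adj a d := by
  rw [segment_eq_image] at h
  obtain ⟨σ, hσ, h⟩ := h
  have had : a ≠ d := fun h => hd (h ▸ ha)
  obtain ⟨h1, h2, h3⟩ := crossing_segments hσ ht h (hQ.dist_le_of_mem hs ha hb) (hQ.dist_le hde)
    (hQ.nonobtuse a d had) (hQ.nonobtuse a e fun h => he (h ▸ ha))
    (hQ.nonobtuse b d fun h => hd (h ▸ hb)) (hQ.nonobtuse b e fun h => he (h ▸ hb))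
  have n1 : 1 - σ ≠ 0 := by
    intro h0
    rw [h0, zero_mul, sub_eq_zero.1 h0 |>.symm, one_mul] at h1
    exact (Q.disk b).radius_pos.ne h1
  have n2 : 1 - t ≠ 0 := by
    intro h0
    rw [h0, zero_mul, sub_eq_zero.1 h0 |>.symm, one_mul] at h2
    exact (Q.disk e).radius_pos.ne h2
  refine ⟨h2, hQ.adj_of_dist_sq_eq had (sub_eq_zero.1 ?_)⟩
  simpa [n1, n2] using h3

/-- If `a` and `d` were adjacent, the face and the edge `[a, d]` would both lie in the star of `a`,
where the center map is injective. -/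
theorem DiskPattern.IsImmersed.not_adj_of_center_mem_hull (himm : Q.IsImmersed T) {s : Finset V}
    (hs : s ∈ T.faces) {a d : V} (ha : a ∈ s) (hd : d ∉ s) (hmem : (Q.disk d).center ∈ Q.hull s) :
    ¬ (oneSkeleton T).Adj a d := by
  classical
  intro hadj
  obtain ⟨x, hx, hxd⟩ := Q.exists_centerMap_eq_of_mem_hull hs hmem
  have := himm.eq_of_mem_star hs (pair_mem_faces hadj) ha (by simp) hx
    (vertexPoint_carried T (by simp)) (hxd.trans (Q.centerMap_vertexPoint d).symm)
  have h0 := hx d hd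
  rw [this, vertexPoint_apply_self] at h0
  exact one_ne_zero h0

/-- The center of a disk does not lie in the triangle of a face of which it is not a vertex. -/
theorem DiskPattern.Fits.center_notMem_hull (hQ : Q.Fits (oneSkeleton T)) (himm : Q.IsImmersed T)
    (hT : IsOpenDiskTriangulation T) {s : Finset V} (hs : s ∈ T.faces) {d : V} (hd : d ∉ s) :
    (Q.disk d).center ∉ Q.hull s := by
  intro hmem
  obtain ⟨u₀, hu₀⟩ := (T.isRelLowerSet_faces hs).1
  obtain ⟨p⟩ := (oneSkeleton_connected hT).preconnected d u₀
  -- A walk from `d` to the face has a step `v`, `u` leaving the set of outside vertices with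
  -- centers in the triangle. If `u` is not a vertex of the face, the step crosses an edge, which
  -- again makes `v` adjacent to a vertex of the face.
  obtain ⟨⟨⟨v, u⟩, hvu⟩, -, ⟨hvs, hv⟩, hu⟩ :=
    p.exists_boundary_dart {v | v ∉ s ∧ (Q.disk v).center ∈ Q.hull s} ⟨hd, hmem⟩
      fun h => h.1 hu₀
  by_cases hus : u ∈ s
  · exact himm.not_adj_of_center_mem_hull hs hus hvs hv hvu.symm
  · have hu' : (Q.disk u).center ∉ Q.hull s := fun h => hu ⟨hus, h⟩
    obtain ⟨w, hw, -, a, ha, b, hb, hab⟩ := himm.exists_mem_segment hT hs hv hu'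
    rw [segment_eq_image] at hw
    obtain ⟨t, ht, rfl⟩ := hw
    exact himm.not_adj_of_center_mem_hull hs ha hvs hv
      (hQ.crossing hs ha hb hvs hus hvu ht hab).2

/-- An edge that has no vertex in common with a triangle does not meet its interior. -/
theorem DiskPattern.Fits.centerMap_notMem_segment (hQ : Q.Fits (oneSkeleton T))
    (himm : Q.IsImmersed T) (hT : IsOpenDiskTriangulation T) {s : Finset V} (hs : s ∈ T.faces)
    (hcard : s.card = 3) {x : geomRealization T} (hx : ∀ v ∉ s, x.1 v = 0)
    (hpos : ∀ v ∈ s, 0 < x.1 v) {d e : V} (hd : d ∉ s) (he : e ∉ s)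
    (hde : (oneSkeleton T).Adj d e) :
    Q.centerMap T x ∉ segment ℝ (Q.disk d).center (Q.disk e).center := by
  classical
  intro hmem
  rw [segment_eq_image] at hmem
  obtain ⟨t, ht, hm⟩ := hmem
  simp only at hm
  have hxs := Q.centerMap_mem_hull x hx
  obtain ⟨w₁, hw₁, -, a, ha, b, hb, hab⟩ :=
    himm.exists_mem_segment hT hs hxs (hQ.center_notMem_hull himm hT hs hd)
  obtain ⟨w₂, hw₂, -, a', ha', b', hb', hab'⟩ :=
    himm.exists_mem_segment hT hs hxs (hQ.center_notMem_hull himm hT hs he)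
  rw [segment_eq_image] at hw₁ hw₂
  obtain ⟨τ, hτ, rfl⟩ := hw₁
  obtain ⟨τ', hτ', rfl⟩ := hw₂
  simp only at hab hab'
  have e₁ : (1 - τ) • Q.centerMap T x + τ • (Q.disk d).center =
      (1 - (1 - τ) * t) • (Q.disk d).center + ((1 - τ) * t) • (Q.disk e).center := by
    rw [← hm]; module
  have e₂ : (1 - τ') • Q.centerMap T x + τ' • (Q.disk e).center =
      (1 - (t + τ' * (1 - t))) • (Q.disk d).center + (t + τ' * (1 - t)) • (Q.disk e).center := by
    rw [← hm]; module
  obtain ⟨ht0, ht1⟩ := ht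
  obtain ⟨hτ0, hτ1⟩ := hτ
  obtain ⟨hτ0', hτ1'⟩ := hτ'
  have c₁ := (hQ.crossing hs ha hb hd he hde (t := (1 - τ) * t)
    ⟨by nlinarith, by nlinarith⟩ (e₁ ▸ hab)).1
  have c₂ := (hQ.crossing hs ha' hb' hd he hde (t := t + τ' * (1 - t))
    ⟨by nlinarith, by nlinarith⟩ (e₂ ▸ hab')).1
  have hr : 0 < (Q.disk d).radius + (Q.disk e).radius := by
    linarith [(Q.disk d).radius_pos, (Q.disk e).radius_pos]
  -- Toward either end, `[d, e]` leaves the triangle at the one point that divides it in the ratio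
  -- of the radii. The two exits coincide, so the given point lies between them and on an edge of
  -- the face, against its positive weights.
  have heq : (1 - τ) * t = t + τ' * (1 - t) :=
    mul_right_cancel₀ hr.ne' (by linarith)
  have h1 : 0 ≤ τ * t := mul_nonneg hτ0 ht0
  have h2 : 0 ≤ τ' * (1 - t) := mul_nonneg hτ0' (by linarith)
  have h3 : (1 - τ) * t = t := by linarith
  rw [e₁, h3, hm] at hab
  have hsub : ({a, b} : Finset V) ⊆ s := by simp [Finset.insert_subset_iff, ha, hb]
  have hf : ({a, b} : Finset V) ∈ T.faces :=
    (T.isRelLowerSet_faces hs).2 hsub (Finset.insert_nonempty _ _)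
  obtain ⟨y, hy, hyx⟩ := Q.exists_centerMap_eq_of_mem_hull hf (z := Q.centerMap T x) (by
    simpa [DiskPattern.hull, image_pair, convexHull_pair] using hab)
  have hxy := himm.eq_of_mem_star hf hs (a := a) (by simp) ha hy hx hyx
  obtain ⟨c, hc, hcab⟩ := Finset.exists_mem_notMem_of_card_lt_card
    (lt_of_le_of_lt Finset.card_le_two (by omega : 2 < s.card) : ({a, b} : Finset V).card < s.card)
  exact (hpos c hc).ne' (hxy ▸ hy c hcab)

/-- Moving from a common value toward a vertex of `t` must cross an edge of `s`. Before the vertex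
is reached the point is still interior to `t`, so an edge or a vertex of `s` would meet the triangle
of `t` in a way already excluded. -/
theorem DiskPattern.Fits.centerMap_ne_of_disjoint (hQ : Q.Fits (oneSkeleton T))
    (himm : Q.IsImmersed T) (hT : IsOpenDiskTriangulation T) {s t : Finset V} (hs : s ∈ T.faces)
    (ht : t ∈ T.faces) (htcard : t.card = 3) (hst : Disjoint s t)
    {x y : geomRealization T} (hx : ∀ v ∉ s, x.1 v = 0) (hy : ∀ v ∉ t, y.1 v = 0)
    (hypos : ∀ v ∈ t, 0 < y.1 v) : Q.centerMap T x ≠ Q.centerMap T y := by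
  intro hxy
  obtain ⟨d, hd⟩ := (T.isRelLowerSet_faces ht).1
  have hds := hQ.center_notMem_hull himm hT hs (Finset.disjoint_right.1 hst hd)
  obtain ⟨w, hw, hws, a, ha, b, hb, hab⟩ :=
    himm.exists_mem_segment hT hs (Q.centerMap_mem_hull x hx) hds
  rw [segment_eq_image] at hw
  obtain ⟨τ, hτ, rfl⟩ := hw
  have hτ1 : τ ≠ 1 := by
    rintro rfl
    exact hds (by simpa using hws)
  have hτ1' : 0 < 1 - τ := sub_pos.2 (lt_of_le_of_ne hτ.2 hτ1)
  have hcombo := Q.centerMap_combo ht y (vertexPoint T d) hy (vertexPoint_carried T hd) hτ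
  rw [← hxy, Q.centerMap_vertexPoint] at hcombo
  simp only [← hcombo] at hab
  set y' : geomRealization T :=
    ⟨_, combo_mem_geomRealization ht y (vertexPoint T d) hy (vertexPoint_carried T hd) hτ⟩
  have hy' : ∀ v ∉ t, y'.1 v = 0 := fun v hv => by
    simp [y', hy v hv, vertexPoint_carried T hd v hv]
  have hypos' : ∀ v ∈ t, 0 < y'.1 v := fun v hv =>
    add_pos_of_pos_of_nonneg (mul_pos hτ1' (hypos v hv))
      (mul_nonneg hτ.1 ((vertexPoint T d).2.1 v))
  have hat := Finset.disjoint_left.1 hst ha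
  have hbt := Finset.disjoint_left.1 hst hb
  by_cases h : a = b
  · subst h
    rw [segment_same, mem_singleton_iff] at hab
    exact hQ.center_notMem_hull himm hT ht hat (hab ▸ Q.centerMap_mem_hull y' hy')
  · exact hQ.centerMap_notMem_segment himm hT ht htcard hy' hypos' hat hbt ⟨h, s, hs, ha, hb⟩ hab

open MeasureTheory in
theorem volume_segment_eq_zero (a b : ℂ) : volume (segment ℝ a b) = 0 := by
  refine measure_mono_null (t := (affineSpan ℝ {a, b} : Set ℂ)) ?_
    (Measure.addHaar_affineSubspace _ _ ?_)
  · rw [← convexHull_pair]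
    exact convexHull_subset_affineSpan _
  · intro htop
    have h1 := collinear_iff_finrank_le_one.1 (collinear_pair ℝ a b)
    rw [← direction_affineSpan, htop, AffineSubspace.direction_top, finrank_top,
      Complex.finrank_real_complex] at h1
    omega

open MeasureTheory in
/-- The center map of an immersed pattern is an embedding. -/
theorem DiskPattern.Fits.centerMap_injective (hQ : Q.Fits (oneSkeleton T))
    (himm : Q.IsImmersed T) (hT : IsOpenDiskTriangulation T) :
    Function.Injective (Q.centerMap T) := by
  intro x y hxy
  by_contra hne
  have := hQ.nonobtuse.countable
  obtain ⟨U, U', hU, hU', hx, hy, hdisj⟩ := t2_separation hne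
  -- A double value persists on an open set, while the edges have measure zero. It can therefore be
  -- moved so that both preimages are interior to triangles.
  have hopen := (himm.isOpenMap hT U hU).inter (himm.isOpenMap hT U' hU')
  have hnull : volume (⋃ p : V × V, segment ℝ (Q.disk p.1).center (Q.disk p.2).center) = 0 :=
    measure_iUnion_null fun p => volume_segment_eq_zero _ _
  obtain ⟨z, ⟨⟨x', hx', hxz⟩, y', hy', hyz⟩, hz⟩ : ∃ z ∈ Q.centerMap T '' U ∩ Q.centerMap T '' U',
      z ∉ ⋃ p : V × V, segment ℝ (Q.disk p.1).center (Q.disk p.2).center := by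
    by_contra! hcon
    exact (hopen.measure_pos volume ⟨Q.centerMap T x, ⟨x, hx, rfl⟩, ⟨y, hy, hxy.symm⟩⟩).ne'
      (measure_mono_null hcon hnull)
  have key : ∀ x : geomRealization T, Q.centerMap T x = z → ∃ s ∈ T.faces, s.card = 3 ∧
      (∀ v ∉ s, x.1 v = 0) ∧ ∀ v ∈ s, 0 < x.1 v := by
    intro x hxz
    obtain ⟨s, hs, h1, h2⟩ := carrier_mem_faces x
    refine ⟨s, hs, le_antisymm (hT.1 s hs) (not_lt.1 fun hlt => hz ?_), h1, h2⟩
    obtain ⟨a, -, b, -, hab⟩ := Q.exists_mem_segment_of_card_lt x hs hlt h1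
    exact mem_iUnion.2 ⟨(a, b), hxz ▸ hab⟩
  obtain ⟨s, hs, -, hsx, -⟩ := key x' hxz
  obtain ⟨t, ht, htc, hty, htpos⟩ := key y' hyz
  have hne' : x' ≠ y' := fun h => disjoint_left.1 hdisj hx' (h ▸ hy')
  refine hQ.centerMap_ne_of_disjoint himm hT hs ht htc (Finset.disjoint_left.2 fun a ha hb => ?_)
    hsx hty htpos (hxz.trans hyz.symm)
  exact hne' (himm.eq_of_mem_star hs ht ha hb hsx hty (hxz.trans hyz.symm))

end Injective

/-! ### Walks that visit every vertex -/

/-- Turns a connected infinite set of vertices into the vertex set of a single path. The walk aims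
at the vertices of an enumeration in turn, along shortest paths. -/
theorem exists_surjective_walk {W : Type*} [Countable W] [Nontrivial W] {H : SimpleGraph W}
    (hH : H.Preconnected) (a : W) :
    ∃ p : ℕ → W, p 0 = a ∧ (∀ k, H.Adj (p k) (p (k + 1))) ∧ Function.Surjective p := by
  classical
  have : Nonempty W := ⟨a⟩
  obtain ⟨e, he⟩ := exists_surjective_nat W
  have toward : ∀ v t, v ≠ t → ∃ w, H.Adj v w ∧ H.dist w t < H.dist v t := by
    intro v t hvt
    obtain ⟨q, hq⟩ := (hH v t).exists_walk_length_eq_dist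
    cases q with
    | nil => exact absurd rfl hvt
    | cons h q' =>
      refine ⟨_, h, ?_⟩
      rw [← hq, SimpleGraph.Walk.length_cons]
      exact Nat.lt_succ_of_le (SimpleGraph.dist_le q')
  have nbr : ∀ v, ∃ w, H.Adj v w := fun v =>
    (exists_ne v).elim fun t ht => (toward v t ht.symm).imp fun _ h => h.1
  choose! tw htw using toward
  choose nb hnb using nbr
  -- The state is the current vertex and the index of the target. At the target the walk must still
  -- move, so it steps to any neighbor.
  let step : W × ℕ → W × ℕ := fun x =>
    if x.1 = e x.2 then (nb x.1, x.2 + 1) else (tw x.1 (e x.2), x.2)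
  have hadj : ∀ x, H.Adj x.1 (step x).1 := by
    intro x
    by_cases h : x.1 = e x.2
    · simp only [step, if_pos h]
      exact hnb _
    · simp only [step, if_neg h]
      exact (htw _ _ h).1
  have hreach : ∀ (m n : ℕ) (v : W), H.dist v (e n) ≤ m → ∃ j, step^[j] (v, n) = (e n, n) := by
    intro m
    induction m with
    | zero =>
      intro n v hv
      have h0 : v = e n := (hH v (e n)).dist_eq_zero_iff.1 (Nat.le_zero.1 hv)
      exact ⟨0, by simp [h0]⟩
    | succ m ih =>
      intro n v hv
      by_cases h : v = e n
      · exact ⟨0, by simp [h]⟩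
      · obtain ⟨j, hj⟩ := ih n (tw v (e n)) (by have := (htw v (e n) h).2; omega)
        refine ⟨j + 1, ?_⟩
        rw [Function.iterate_succ_apply]
        simp only [step, if_neg h]
        exact hj
  have hall : ∀ n, ∃ k, step^[k] (a, 0) = (e n, n) := by
    intro n
    induction n with
    | zero => exact hreach _ 0 a le_rfl
    | succ n ih =>
      obtain ⟨k, hk⟩ := ih
      obtain ⟨j, hj⟩ := hreach _ (n + 1) (nb (e n)) le_rfl
      refine ⟨j + (k + 1), ?_⟩
      rw [Function.iterate_add_apply, Function.iterate_succ_apply', hk]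
      simpa [step] using hj
  refine ⟨fun k => (step^[k] (a, 0)).1, rfl, fun k => ?_, fun w => ?_⟩
  · simp only [Function.iterate_succ_apply']
    exact hadj _
  · obtain ⟨n, rfl⟩ := he w
    obtain ⟨k, hk⟩ := hall n
    exact ⟨k, by simp [hk]⟩

/-! ### A length-area criterion for positive modulus -/

open MeasureTheory in
-- Length-area argument: integrating the admissibility inequality over `J` bounds `volume J` by the
-- pairing of `η` with the volumes of the sets `E v`, which is small when the area of `η` is.
theorem vertexModulus_ne_zero [Countable V] {Γ : Set (Set V)} {E : V → Set ℝ} {J : Set ℝ}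
    (hE : ∀ v, MeasurableSet (E v)) (hJ : volume J ≠ 0)
    (hJm : MeasurableSet J) (hΓ : ∀ r ∈ J, ∃ γ ∈ Γ, ∀ v ∈ γ, r ∈ E v)
    (hsum : ∑' v, volume (E v) ^ 2 ≠ ⊤) : vertexModulus Γ ≠ 0 := by
  intro h0
  set S := ∑' v, volume (E v) ^ 2
  have hlen : ∀ η : V → ℝ≥0, Admissible Γ η → volume J ≤ ∑' v, η v * volume (E v) := by
    intro η hη
    calc volume J = ∫⁻ _ in J, 1 := by simp
      _ ≤ ∫⁻ r in J, ∑' v, (η v : ℝ≥0∞) * (E v).indicator 1 r := by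
          refine setLIntegral_mono' hJm fun r hr => ?_
          obtain ⟨γ, hγ, hγE⟩ := hΓ r hr
          refine (hη γ hγ).trans ?_
          rw [length, tsum_subtype γ fun v => (η v : ℝ≥0∞)]
          refine ENNReal.tsum_le_tsum fun v => ?_
          by_cases hv : v ∈ γ
          · simp [hv, hγE v hv]
          · simp [hv]
      _ ≤ ∫⁻ r, ∑' v, (η v : ℝ≥0∞) * (E v).indicator 1 r := setLIntegral_le_lintegral _ _
      _ = ∑' v, η v * volume (E v) := by
          rw [lintegral_tsum fun v =>
            ((measurable_one.indicator (hE v)).const_mul _).aemeasurable]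
          refine tsum_congr fun v => ?_
          rw [lintegral_const_mul _ (measurable_one.indicator (hE v)),
            lintegral_indicator_one (hE v)]
  have hfin : ∀ v, volume (E v) ≠ ⊤ := by
    intro v hv
    have := ENNReal.ne_top_of_tsum_ne_top hsum v
    simp [hv] at this
  -- Weighted form of Cauchy–Schwarz; with area below `(n + 1)⁻²`, both resulting terms are of order
  -- `(n + 1)⁻¹`.
  have hyoung : ∀ (n : ℕ) (x : ℝ≥0) (y : ℝ≥0∞), y ≠ ⊤ →
      (x : ℝ≥0∞) * y ≤ (n + 1 : ℕ) * (x : ℝ≥0∞) ^ 2 + ((n + 1 : ℕ) : ℝ≥0∞)⁻¹ * y ^ 2 := by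
    intro n x y hy
    lift y to ℝ≥0 using hy
    have hc : (((n + 1 : ℕ) : ℝ≥0∞)⁻¹) = (((n + 1 : ℕ) : ℝ≥0)⁻¹ : ℝ≥0) := by
      rw [ENNReal.coe_inv (by simp)]
      simp
    rw [hc]
    norm_cast
    rw [← NNReal.coe_le_coe]
    push_cast
    have hn : (0 : ℝ) < n + 1 := by positivity
    have e : ((n : ℝ) + 1) * x ^ 2 + ((n : ℝ) + 1)⁻¹ * y ^ 2 - x * y =
        ((n : ℝ) + 1)⁻¹ * ((((n : ℝ) + 1) * x - y / 2) ^ 2 + 3 / 4 * y ^ 2) := by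
      field_simp
      ring
    have : 0 ≤ ((n : ℝ) + 1)⁻¹ * ((((n : ℝ) + 1) * x - y / 2) ^ 2 + 3 / 4 * y ^ 2) := by
      positivity
    linarith
  have hle : ∀ n : ℕ, volume J ≤ ((n + 1 : ℕ) : ℝ≥0∞)⁻¹ * (1 + S) := by
    intro n
    have hn : ((n + 1 : ℕ) : ℝ≥0∞) ≠ 0 := by simp
    have hn' : ((n + 1 : ℕ) : ℝ≥0∞) ≠ ⊤ := ENNReal.natCast_ne_top _
    obtain ⟨η, hη, hlt⟩ : ∃ η : V → ℝ≥0, Admissible Γ η ∧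
        area η < ((n + 1 : ℕ) : ℝ≥0∞)⁻¹ * ((n + 1 : ℕ) : ℝ≥0∞)⁻¹ := by
      have : vertexModulus Γ < ((n + 1 : ℕ) : ℝ≥0∞)⁻¹ * ((n + 1 : ℕ) : ℝ≥0∞)⁻¹ := by
        rw [h0]
        exact ENNReal.mul_pos (ENNReal.inv_ne_zero.2 hn') (ENNReal.inv_ne_zero.2 hn')
      simpa [vertexModulus, iInf_lt_iff] using this
    calc volume J ≤ ∑' v, η v * volume (E v) := hlen η hη
      _ ≤ ∑' v, ((n + 1 : ℕ) * (η v : ℝ≥0∞) ^ 2 +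
            ((n + 1 : ℕ) : ℝ≥0∞)⁻¹ * volume (E v) ^ 2) :=
          ENNReal.tsum_le_tsum fun v => hyoung n _ _ (hfin v)
      _ = (n + 1 : ℕ) * area η + ((n + 1 : ℕ) : ℝ≥0∞)⁻¹ * S := by
          rw [ENNReal.tsum_add, ENNReal.tsum_mul_left, ENNReal.tsum_mul_left, area]
      _ ≤ ((n + 1 : ℕ) : ℝ≥0∞)⁻¹ + ((n + 1 : ℕ) : ℝ≥0∞)⁻¹ * S := by
          gcongr
          refine (mul_le_mul_right hlt.le _).trans (le_of_eq ?_)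
          rw [← mul_assoc, ENNReal.mul_inv_cancel hn hn', one_mul]
      _ = _ := by rw [mul_add, mul_one]
  have hlim : Tendsto (fun n : ℕ => ((n + 1 : ℕ) : ℝ≥0∞)⁻¹ * (1 + S)) atTop (𝓝 (0 * (1 + S))) :=
    ENNReal.Tendsto.mul_const
      ((tendsto_add_atTop_iff_nat 1).2 ENNReal.tendsto_inv_nat_nhds_zero)
      (Or.inr (ENNReal.add_ne_top.2 ⟨ENNReal.one_ne_top, hsum⟩))
  rw [zero_mul] at hlim
  exact hJ (le_antisymm (ge_of_tendsto' hlim hle) zero_le)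

/-! ### Parabolic immersed patterns are locally finite -/

theorem DiskPattern.Nonobtuse.finite_large {Q : DiskPattern V} (hQ : Q.Nonobtuse) (p : ℂ) (M : ℝ) :
    {v | ((Q.disk v).toSet ∩ Metric.closedBall p M).Nonempty ∧ 1 ≤ (Q.disk v).radius}.Finite := by
  have h := (hQ.tsum_sq_le p (M := M) one_pos).trans_lt
    (ENNReal.mul_lt_top (by simp) (ENNReal.pow_lt_top ENNReal.ofReal_lt_top))
  refine ((ENNReal.finite_const_le_of_tsum_ne_top h.ne one_ne_zero).image Subtype.val).subset ?_
  rintro v ⟨h1, h2⟩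
  refine ⟨⟨v, h1⟩, ?_, rfl⟩
  change 1 ≤ ENNReal.ofReal (min (Q.disk v).radius 1) ^ 2
  simp [min_eq_right h2]

section Parabolic

variable {T : AbstractSimplicialComplex V} {Q : DiskPattern V}

/-- Only finitely many large disks meet `K`. The small ones have centers in a compact ball, covered
by finitely many images of open stars, and by injectivity each such image contains only one center.
-/
theorem DiskPattern.locallyFiniteIn_of_surjective (hQ : Q.Nonobtuse)
    (hopen : IsOpenMap (Q.centerMap T)) (hinj : Function.Injective (Q.centerMap T))
    (hsurj : Function.Surjective (Q.centerMap T)) : Q.LocallyFiniteIn univ := by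
  refine ⟨fun _ => subset_univ _, fun K _ hK => ?_⟩
  obtain ⟨M, hM⟩ := hK.isBounded.subset_closedBall 0
  have hcov : Metric.closedBall (0 : ℂ) (M + 1) ⊆
      ⋃ v, Q.centerMap T '' {x : geomRealization T | 0 < x.1 v} := by
    intro z _
    obtain ⟨x, rfl⟩ := hsurj z
    obtain ⟨v, hv⟩ := exists_pos T x
    exact mem_iUnion.2 ⟨v, x, hv, rfl⟩
  obtain ⟨t, ht⟩ := (isCompact_closedBall (0 : ℂ) (M + 1)).elim_finite_subcover _
    (fun v => hopen _ (isOpen_openStar T v)) hcov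
  refine ((hQ.finite_large 0 M).union t.finite_toSet).subset ?_
  rintro v ⟨z, hz, hzK⟩
  have hz0 : dist z 0 ≤ M := hM hzK
  by_cases hr : 1 ≤ (Q.disk v).radius
  · exact Or.inl ⟨⟨z, hz, hM hzK⟩, hr⟩
  · have hzv : dist z (Q.disk v).center ≤ (Q.disk v).radius := hz
    have hc : (Q.disk v).center ∈ Metric.closedBall (0 : ℂ) (M + 1) := by
      rw [Metric.mem_closedBall]
      linarith [dist_triangle_left (Q.disk v).center 0 z, not_le.1 hr]
    obtain ⟨w, hw, x, hx, hxv⟩ := mem_iUnion₂.1 (ht hc)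
    have hxv' : x = vertexPoint T v := hinj (hxv.trans (Q.centerMap_vertexPoint v).symm)
    by_cases hvw : w = v
    · exact Or.inr (hvw ▸ hw)
    · have hx : 0 < x.1 w := hx
      rw [hxv', vertexPoint_apply_ne T hvw] at hx
      exact absurd hx (lt_irrefl _)

/-- A circle around a point that is omitted by the center map is not covered by its image. -/
theorem DiskPattern.exists_sphere_notMem_range (hT : IsOpenDiskTriangulation T)
    (hopen : IsOpenMap (Q.centerMap T)) (hinj : Function.Injective (Q.centerMap T)) {p : ℂ}
    (hp : p ∉ range (Q.centerMap T)) {r : ℝ} (hr : 0 < r) :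
    ∃ z ∈ Metric.sphere p r, z ∉ range (Q.centerMap T) := by
  by_contra! hcon
  obtain ⟨e⟩ := hT.2
  have : ContractibleSpace (Metric.ball (0 : ℂ) 1) := Metric.contractibleSpace_ball one_pos
  have : LocallyPathConnectedSpace (Metric.ball (0 : ℂ) 1) :=
    Metric.isOpen_ball.locallyPathConnectedSpace
  set φ : Metric.ball (0 : ℂ) 1 → ℂ := Q.centerMap T ∘ e.symm with hφ
  have hemb : IsOpenEmbedding φ := .of_continuous_injective_isOpenMap
    ((Q.continuous_centerMap hT).comp e.symm.continuous) (hinj.comp e.symm.injective)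
    (hopen.comp e.symm.isOpenMap)
  -- The realization is simply connected, so `φ - p` has a logarithm; a circle inside the image
  -- would carry it over to a logarithm of `z - p`.
  obtain ⟨g, hg, hge⟩ := exists_continuous_log (f := fun a => φ a - p)
    (hemb.continuous.sub continuous_const) fun a ha => hp ⟨_, sub_eq_zero.1 ha⟩
  have hext : ∀ a, Function.extend φ g 0 (φ a) = g a := hemb.injective.extend_apply g 0
  have hrange : ∀ z ∈ Metric.sphere p r, ∃ a, φ a = z := by
    intro z hz
    obtain ⟨x, rfl⟩ := hcon z hz
    exact ⟨e x, by simp [hφ]⟩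
  refine not_exists_continuous_log_sphere (p := p) hr (g := Function.extend φ g 0) ?_ ?_
  · intro z hz
    obtain ⟨a, rfl⟩ := hrange z hz
    refine (hemb.continuousAt_iff.1 ?_).continuousWithinAt
    have : Function.extend φ g 0 ∘ φ = g := funext hext
    rw [this]
    exact hg.continuousAt
  · intro z hz
    obtain ⟨a, rfl⟩ := hrange z hz
    rw [hext, hge]

/-- A vertex whose open star comes close to an omitted point either has its disk close to this
point, or is adjacent to a vertex whose disk is large and close to this point. -/
theorem DiskPattern.Fits.near_or_adj (hQ : Q.Fits (oneSkeleton T)) (himm : Q.IsImmersed T)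
    (hT : IsOpenDiskTriangulation T) {p : ℂ} (hp : p ∉ range (Q.centerMap T)) {R : ℝ}
    {v : V} {x : geomRealization T} (hx : 0 < x.1 v) (hR : dist (Q.centerMap T x) p ≤ R) :
    ((Q.disk v).toSet ∩ Metric.closedBall p (R + 2)).Nonempty ∨
      ∃ j, (((Q.disk j).toSet ∩ Metric.closedBall p (R + 2)).Nonempty ∧
        1 ≤ (Q.disk j).radius) ∧ (oneSkeleton T).Adj j v := by
  obtain ⟨s, hs, hsx, hpos⟩ := carrier_mem_faces x
  have hvs : v ∈ s := by_contra fun h => hx.ne' (hsx v h)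
  have hps : p ∉ Q.hull s := fun h =>
    let ⟨y, _, hy⟩ := Q.exists_centerMap_eq_of_mem_hull hs h
    hp ⟨y, hy⟩
  obtain ⟨w, hw, -, a, ha, b, hb, hab⟩ :=
    himm.exists_mem_segment hT hs (Q.centerMap_mem_hull x hsx) hps
  have hwp : dist w p ≤ R :=
    (convex_closedBall p R).segment_subset hR
      (Metric.mem_closedBall_self (dist_nonneg.trans hR)) hw
  -- The disks at the ends of an edge overlap, so they cover the segment between their centers.
  obtain ⟨j, hj, hwj⟩ : ∃ j ∈ s, dist w (Q.disk j).center ≤ (Q.disk j).radius := by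
    have h1 := dist_add_dist_of_mem_segment hab
    have h2 := hQ.dist_le_of_mem hs ha hb
    by_contra! hcon
    have h3 := hcon a ha
    have h4 := hcon b hb
    rw [dist_comm] at h3
    linarith
  by_cases hjv : j = v
  · exact Or.inl ⟨w, hjv ▸ hwj, by rw [Metric.mem_closedBall]; linarith⟩
  have hadj : (oneSkeleton T).Adj j v := ⟨hjv, s, hs, hj, hvs⟩
  by_cases hr : 1 ≤ (Q.disk j).radius
  · exact Or.inr ⟨j, ⟨⟨w, hwj, by rw [Metric.mem_closedBall]; linarith⟩, hr⟩, hadj⟩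
  · left
    obtain ⟨y, hy1, hy2⟩ := exists_dist_le_le (Q.disk j).radius_pos.le (Q.disk v).radius_pos.le
      ((hQ.dist_le hadj).trans_eq (add_comm _ _))
    refine ⟨y, hy2, ?_⟩
    rw [Metric.mem_closedBall]
    rw [dist_comm] at hy1
    linarith [dist_triangle y (Q.disk j).center p, dist_triangle_left (Q.disk j).center p w,
      not_le.1 hr]

/-- Each point of the realization lies in the open star of a vertex whose disk is not much smaller
than its distance to the center. -/
theorem DiskPattern.Fits.exists_dist_lt (hQ : Q.Fits (oneSkeleton T)) (x : geomRealization T) :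
    ∃ v, 0 < x.1 v ∧ dist (Q.centerMap T x) (Q.disk v).center < 3 * (Q.disk v).radius := by
  obtain ⟨s, hs, hsx, hpos⟩ := carrier_mem_faces x
  obtain ⟨v, hv, hmax⟩ := s.exists_max_image (fun v => (Q.disk v).radius)
    (T.isRelLowerSet_faces hs).1
  refine ⟨v, hpos v hv, ?_⟩
  have hsub : Q.hull s ⊆ Metric.closedBall (Q.disk v).center (2 * (Q.disk v).radius) := by
    refine convexHull_min ?_ (convex_closedBall _ _)
    rintro _ ⟨u, hu, rfl⟩
    rw [Metric.mem_closedBall]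
    linarith [hQ.dist_le_of_mem hs hu hv, hmax u hu]
  have := hsub (Q.centerMap_mem_hull x hsx)
  rw [Metric.mem_closedBall] at this
  linarith [(Q.disk v).radius_pos]

/-- Finitely many open stars are contained in the preimage of a closed subset of the image of the
center map. -/
theorem DiskPattern.exists_isClosed_of_finite (Q : DiskPattern V) (hT : IsOpenDiskTriangulation T)
    {W : Set V} (hW : W.Finite) : ∃ C : Set ℂ, IsClosed C ∧ C ⊆ range (Q.centerMap T) ∧
      ∀ x : geomRealization T, ∀ v ∈ W, 0 < x.1 v → Q.centerMap T x ∈ C := by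
  classical
  have hfin : ∀ v, {s | s ∈ T.faces ∧ v ∈ s}.Finite := by
    intro v
    refine (insert v (finite_setOf_adj hT v).toFinset).powerset.finite_toSet.subset ?_
    rintro s ⟨hs, hv⟩
    simp only [Finset.coe_powerset, mem_preimage, mem_powerset_iff, Finset.coe_subset]
    intro w hw
    by_cases hwv : w = v
    · simp [hwv]
    · simp only [Finset.mem_insert, hwv, Finite.mem_toFinset, false_or]
      exact ⟨Ne.symm hwv, s, hs, hv, hw⟩
  refine ⟨⋃ v ∈ W, ⋃ s ∈ {s | s ∈ T.faces ∧ v ∈ s}, Q.hull s,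
    hW.isClosed_biUnion fun v _ => (hfin v).isClosed_biUnion fun s _ => Q.isClosed_hull s, ?_, ?_⟩
  · intro z hz
    simp only [mem_iUnion] at hz
    obtain ⟨v, -, s, ⟨hs, -⟩, hz⟩ := hz
    obtain ⟨x, -, hx⟩ := Q.exists_centerMap_eq_of_mem_hull hs hz
    exact ⟨x, hx⟩
  · intro x v hv hx
    obtain ⟨s, hs, hsx, -⟩ := carrier_mem_faces x
    refine mem_biUnion hv (mem_biUnion (show s ∈ {s | s ∈ T.faces ∧ v ∈ s} from
      ⟨hs, by_contra fun h => hx.ne' (hsx v h)⟩) (Q.centerMap_mem_hull x hsx))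

end Parabolic

/-! ### The image of a parabolic immersed pattern is the plane -/

section Parabolic

variable {T : AbstractSimplicialComplex V} {Q : DiskPattern V}

/-- The circle is followed from `z₀` up to its first exit from `Ω`. The exit point is in the closure
of the half-open arc, so no closed subset of `Ω` contains the arc. -/
theorem exists_arc_exit {Ω : Set ℂ} (hΩ : IsOpen Ω) {p z₀ : ℂ} (hz₀ : z₀ ∈ Ω) (hne : z₀ ≠ p)
    (hexit : ∃ z ∈ Metric.sphere p (dist z₀ p), z ∉ Ω) :
    ∃ A ⊆ Ω, IsPreconnected A ∧ z₀ ∈ A ∧ A ⊆ Metric.sphere p (dist z₀ p) ∧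
      ∀ C, IsClosed C → A ⊆ C → ¬ C ⊆ Ω := by
  set γ : ℝ → ℂ := fun θ => p + (z₀ - p) * Complex.exp (θ * Complex.I) with hγ
  have hγc : Continuous γ := by fun_prop
  have hγ0 : γ 0 = z₀ := by simp [hγ]
  set S : Set ℝ := Ici 0 ∩ γ ⁻¹' Ωᶜ
  have hSc : IsClosed S := isClosed_Ici.inter (hΩ.isClosed_compl.preimage hγc)
  have hSb : BddBelow S := ⟨0, fun θ h => h.1⟩
  have hsub : z₀ - p ≠ 0 := sub_ne_zero.2 hne
  have hSne : S.Nonempty := by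
    obtain ⟨z, hz, hzΩ⟩ := hexit
    have hu : ‖(z - p) / (z₀ - p)‖ = 1 := by
      rw [norm_div, ← dist_eq_norm, ← dist_eq_norm, Metric.mem_sphere.1 hz]
      exact div_self (dist_ne_zero.2 hne)
    have hexp : Complex.exp (((z - p) / (z₀ - p)).arg * Complex.I) = (z - p) / (z₀ - p) := by
      have := Complex.norm_mul_exp_arg_mul_I ((z - p) / (z₀ - p))
      rwa [hu, Complex.ofReal_one, one_mul] at this
    refine ⟨((z - p) / (z₀ - p)).arg + 2 * Real.pi, ?_, ?_⟩
    · rw [mem_Ici]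
      linarith [Complex.neg_pi_lt_arg ((z - p) / (z₀ - p)), Real.pi_pos]
    · have : γ (((z - p) / (z₀ - p)).arg + 2 * Real.pi) = z := by
        simp only [hγ, Complex.ofReal_add, add_mul, Complex.exp_add, hexp, Complex.ofReal_mul,
          Complex.ofReal_ofNat, Complex.exp_two_pi_mul_I, mul_one]
        rw [mul_div_cancel₀ _ hsub, add_sub_cancel]
      rw [mem_preimage, this]
      exact hzΩ
  have hmem : sInf S ∈ S := hSc.csInf_mem hSne hSb
  have hpos : 0 < sInf S := by
    refine lt_of_le_of_ne hmem.1 fun h => hmem.2 ?_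
    rw [← h, hγ0]
    exact hz₀
  refine ⟨γ '' Ico 0 (sInf S), ?_, isPreconnected_Ico.image _ hγc.continuousOn,
    ⟨0, ⟨le_rfl, hpos⟩, hγ0⟩, ?_, ?_⟩
  · rintro _ ⟨θ, hθ, rfl⟩
    by_contra h
    exact notMem_of_lt_csInf hθ.2 hSb ⟨hθ.1, h⟩
  · rintro _ ⟨θ, -, rfl⟩
    rw [mem_sphere_iff_norm, hγ]
    simp only
    rw [add_sub_cancel_left, norm_mul, Complex.norm_exp_ofReal_mul_I, mul_one, dist_eq_norm]
  · intro C hC hAC hCΩ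
    have h1 : sInf S ∈ closure (Ico 0 (sInf S)) := by
      rw [closure_Ico hpos.ne]
      exact ⟨hpos.le, le_rfl⟩
    have h2 : γ (sInf S) ∈ closure (γ '' Ico 0 (sInf S)) :=
      image_closure_subset_closure_image hγc ⟨_, h1, rfl⟩
    exact hmem.2 (hCΩ (closure_minimal hAC hC h2))

open MeasureTheory in
theorem DiskPattern.Fits.centerMap_surjective (hQ : Q.Fits (oneSkeleton T))
    (himm : Q.IsImmersed T) (hT : IsOpenDiskTriangulation T) (hP : VELParabolic (oneSkeleton T)) :
    Function.Surjective (Q.centerMap T) := by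
  have hV := hQ.nonobtuse.countable
  have hopen := himm.isOpenMap hT
  have hinj := hQ.centerMap_injective himm hT
  have hcont := Q.continuous_centerMap hT
  by_contra hsurj
  obtain ⟨p, hp⟩ : ∃ p, p ∉ range (Q.centerMap T) := by
    by_contra! h
    exact hsurj h
  obtain ⟨-, V₀, -, ⟨v₀, hv₀⟩, hvel⟩ := hP
  rw [vertexExtremalLength, ENNReal.inv_eq_top] at hvel
  set U : V → Set (geomRealization T) := fun v =>
    {x | 0 < x.1 v} ∩ {x | dist (Q.centerMap T x) (Q.disk v).center < 3 * (Q.disk v).radius}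
  have hU : ∀ v, IsOpen (U v) := fun v =>
    (isOpen_openStar T v).inter (isOpen_lt (by fun_prop) continuous_const)
  have hUcov : ∀ x, ∃ v, x ∈ U v := hQ.exists_dist_lt
  set q := (Q.disk v₀).center
  have hqU : q ∈ Q.centerMap T '' U v₀ := by
    refine ⟨vertexPoint T v₀, ⟨?_, ?_⟩, Q.centerMap_vertexPoint v₀⟩
    · simp [vertexPoint_apply_self]
    · simp [Q.centerMap_vertexPoint, (Q.disk v₀).radius_pos]
  obtain ⟨ρ, hρ, hball⟩ := Metric.isOpen_iff.1 (hopen _ (hU v₀)) q hqU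
  have hΩball : Metric.ball q ρ ⊆ range (Q.centerMap T) := hball.trans (image_subset_range _ _)
  set R := dist q p with hR
  have hρR : ρ ≤ R := by
    by_contra! h
    exact hp (hΩball (by rwa [Metric.mem_ball, dist_comm]))
  have hR0 : 0 < R := hρ.trans_le hρR
  set Rel : Set V := {v | ∃ x : geomRealization T, 0 < x.1 v ∧ dist (Q.centerMap T x) p ≤ R}
  set J := Ioo (R - ρ) R
  -- Contains every radius in `J` whose arc meets the image of `U v`. The restriction to `Rel` is
  -- what makes the squared measures summable.
  set E : V → Set ℝ := fun v => {r | v ∈ Rel} ∩ (J ∩ Icc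
    (dist (Q.disk v).center p - 3 * (Q.disk v).radius)
    (dist (Q.disk v).center p + 3 * (Q.disk v).radius))
  have hEm : ∀ v, MeasurableSet (E v) := fun v =>
    (MeasurableSet.const _).inter (measurableSet_Ioo.inter measurableSet_Icc)
  -- The term 6 bounds the window of width `6 * radius` for a small disk, and `ρ` is the length of
  -- `J`, used for a large one.
  have hEvol : ∀ v, volume (E v) ≤
      ENNReal.ofReal ((6 + ρ) * min (Q.disk v).radius 1) := by
    intro v
    have hr := (Q.disk v).radius_pos
    rcases le_total (Q.disk v).radius 1 with h | h
    · refine (measure_mono (inter_subset_right.trans inter_subset_right)).trans ?_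
      rw [Real.volume_Icc, min_eq_left h]
      exact ENNReal.ofReal_le_ofReal (by nlinarith)
    · refine (measure_mono (inter_subset_right.trans inter_subset_left)).trans ?_
      rw [Real.volume_Ioo, min_eq_right h]
      exact ENNReal.ofReal_le_ofReal (by linarith)
  refine vertexModulus_ne_zero (Γ := curvesToInfinity (oneSkeleton T) V₀) (E := E) (J := J) hEm
    (by simp [J, hρ]) measurableSet_Ioo ?_ ?_ hvel
  · rintro r ⟨hr1, hr2⟩
    have hr0 : 0 < r := by linarith
    set z₀ : ℂ := p + (r / R : ℝ) * (q - p) with hz₀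
    have hz₀p : dist z₀ p = r := by
      rw [dist_eq_norm, hz₀, add_sub_cancel_left, norm_mul, Complex.norm_real,
        Real.norm_of_nonneg (by positivity), ← dist_eq_norm, ← hR, div_mul_cancel₀ _ hR0.ne']
    have hz₀q : z₀ ∈ Metric.ball q ρ := by
      have e : z₀ - q = ((r / R - 1 : ℝ) : ℂ) * (q - p) := by
        rw [hz₀]; push_cast; ring
      rw [mem_ball_iff_norm, e, norm_mul, Complex.norm_real, Real.norm_eq_abs,
        abs_of_nonpos (by rw [sub_nonpos]; exact (div_le_one hR0).2 hr2.le), ← dist_eq_norm, ← hR]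
      have : -(r / R - 1) * R = R - r := by field_simp; ring
      linarith
    obtain ⟨x₀, hx₀U, hx₀⟩ := hball hz₀q
    obtain ⟨A, hAΩ, hApc, hz₀A, hAs, hAesc⟩ := exists_arc_exit hopen.isOpen_range
      ⟨x₀, hx₀⟩ (fun h => by rw [h, dist_self] at hz₀p; exact hr0.ne hz₀p)
      (hz₀p ▸ Q.exists_sphere_notMem_range hT hopen hinj hp hr0)
    set B := Q.centerMap T ⁻¹' A
    have hB : IsPreconnected B := hApc.preimage_of_isOpenMap hinj hopen hAΩ
    set W := {v | (B ∩ U v).Nonempty}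
    have hv₀W : v₀ ∈ W := ⟨x₀, by rw [mem_preimage, hx₀]; exact hz₀A, hx₀U⟩
    -- Finitely many open stars map into a closed subset of the image, and the arc lies in no such
    -- subset.
    have hWinf : W.Infinite := by
      intro hfin
      obtain ⟨C, hC, hCΩ, hCmem⟩ := Q.exists_isClosed_of_finite hT hfin
      refine hAesc C hC (fun z hz => ?_) hCΩ
      obtain ⟨x, rfl⟩ := hAΩ hz
      obtain ⟨v, hv⟩ := hUcov x
      exact hCmem x v ⟨x, hz, hv⟩ hv.1
    have hpre := induce_preconnected_of_isPreconnected hB hU (fun v x hx => hx.1)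
      (fun x _ => mem_iUnion.2 (hUcov x))
    have : Infinite W := hWinf.to_subtype
    obtain ⟨f, hf0, hfadj, hfsurj⟩ := exists_surjective_walk hpre ⟨v₀, hv₀W⟩
    have hrange : range (fun k => (f k : V)) = W := by
      change range (Subtype.val ∘ f) = W
      rw [range_comp, hfsurj.range_eq, image_univ, Subtype.range_coe]
    refine ⟨W, ⟨fun k => f k, ?_, hfadj, hrange ▸ hWinf, hrange.symm⟩, ?_⟩
    · simpa [hf0] using hv₀
    · rintro v ⟨x, hxB, hxU⟩
      have hxr : dist (Q.centerMap T x) p = r := (Metric.mem_sphere.1 (hAs hxB)).trans hz₀p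
      have hxv : dist (Q.centerMap T x) (Q.disk v).center < 3 * (Q.disk v).radius := hxU.2
      refine ⟨⟨x, hxU.1, by rw [hxr]; exact hr2.le⟩, ⟨hr1, hr2⟩, ?_, ?_⟩
      · linarith [dist_triangle_left (Q.disk v).center p (Q.centerMap T x)]
      · linarith [dist_triangle (Q.centerMap T x) (Q.disk v).center p]
  · set M : Set V := {v | ((Q.disk v).toSet ∩ Metric.closedBall p (R + 2)).Nonempty}
    -- Neighbors of the finitely many large disks near `p`: their own disks may be far from `p`, but
    -- finite degree leaves only finitely many.
    set N : Set V := ⋃ j ∈ {v | ((Q.disk v).toSet ∩ Metric.closedBall p (R + 2)).Nonempty ∧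
      1 ≤ (Q.disk v).radius}, {v | (oneSkeleton T).Adj j v}
    have hN : N.Finite :=
      (hQ.nonobtuse.finite_large p (R + 2)).biUnion fun j _ => finite_setOf_adj hT j
    have hRel : Rel ⊆ M ∪ N := by
      rintro v ⟨x, hx, hxR⟩
      rcases hQ.near_or_adj himm hT hp hx hxR with h | ⟨j, hj, hjv⟩
      · exact Or.inl h
      · exact Or.inr (mem_biUnion hj hjv)
    have hM : ∑' v : M, volume (E v) ^ 2 ≠ ⊤ := by
      have h1 : ∑' v : M, volume (E v) ^ 2 ≤ ∑' v : M, ENNReal.ofReal (6 + ρ) ^ 2 *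
          ENNReal.ofReal (min (Q.disk v).radius 1) ^ 2 := by
        refine ENNReal.tsum_le_tsum fun v => ?_
        rw [← mul_pow, ← ENNReal.ofReal_mul (by positivity)]
        exact pow_le_pow_left' (hEvol v) 2
      rw [ENNReal.tsum_mul_left] at h1
      refine ne_top_of_le_ne_top (ENNReal.mul_ne_top (by finiteness) ?_) h1
      exact ne_top_of_le_ne_top (by finiteness) (hQ.nonobtuse.tsum_sq_le p one_pos)
    have hNsum : ∑' v : N, volume (E v) ^ 2 ≠ ⊤ := by
      have := hN.fintype
      rw [tsum_fintype]
      exact ENNReal.sum_ne_top.2 fun v _ =>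
        ENNReal.pow_ne_top (ne_top_of_le_ne_top ENNReal.ofReal_ne_top (hEvol v))
    have hsupp : Function.support (fun v => volume (E v) ^ 2) ⊆ M ∪ N := by
      intro v hv
      by_contra h
      refine hv ?_
      have : E v = ∅ := by
        rw [eq_empty_iff_forall_notMem]
        exact fun r hr => h (hRel hr.1)
      simp [this]
    rw [← tsum_subtype_eq_of_support_subset hsupp]
    exact ne_top_of_le_ne_top (ENNReal.add_ne_top.2 ⟨hM, hNsum⟩)
      (ENNReal.tsum_union_le (fun v => volume (E v) ^ 2) M N)

end Parabolic

end HePattern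
end

open HePattern
theorem corollary6p2 {V : Type*} (T : AbstractSimplicialComplex V)
    (hT : IsOpenDiskTriangulation T) (G : SimpleGraph V) (hG : G = oneSkeleton T)
    (Θ : G.edgeSet → ℝ) (hΘ : ∀ e, Θ e ∈ Set.Icc 0 (Real.pi / 2))
    (Q : DiskPattern V) (hQ : Q.Realizes Θ) :
    (Q.LocallyFiniteIn Set.univ → VELParabolic G) ∧
      (Q.IsImmersed T → VELParabolic G → Q.LocallyFiniteIn Set.univ) := by
  subst hG
  have hfit := hQ.fits hΘ
  refine ⟨fun hlf => velParabolic_of_locallyFiniteIn (oneSkeleton_connected hT) hfit.nonobtuse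
    (fun u v h => ?_) hlf, fun himm hP => ?_⟩
  · have : Q.contactGraph.Adj u v := hQ.1 ▸ Or.inl h
    exact this.2
  · exact DiskPattern.locallyFiniteIn_of_surjective hfit.nonobtuse (himm.isOpenMap hT)
      (hfit.centerMap_injective himm hT) (hfit.centerMap_surjective himm hT hP)
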